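/- Let $\mathcal X_1,\mathcal X_2,\mathcal Y_1,\mathcal Y_2,\mathcal Z$ be finite alphabets and let $P_{Y_1|X_1}$, $P_{Y_2|X_2}$, $P_{Z|X_1,X_2}$ be conditional probability mass functions. The channel $P_{Y_1,Y_2,Z|X_1,X_2}=P_{Y_1|X_1}P_{Y_2|X_2}P_{Z|X_1,X_2}$ is used $n$ times without memory. For real $R_1,R_2,R_c$, an $(n,2^{nR_1},2^{nR_2},2^{nR_c})$-code consists of message sets $\mathcal M_j=\{1,\dots,\lceil 2^{nR_j}\rceil\}$ for $j\in\{1,2\}$ and $\mathcal M_c=\{1,\dots,\lfloor 2^{nR_c}\rfloor\}$, a coordination function $c:\mathcal M_1\to\mathcal M_c$, encoding functions $\boldsymbol x_1^n:\mathcal M_1\to\mathcal X_1^n$ and $\boldsymbol x_2^n:\mathcal M_2\times\mathcal M_c\to\mathcal X_2^n$, and decoding functions $\hat m_j:\mathcal Y_j^n\to\mathcal M_j\cup\{e\}$ for $j\in\{1,2\}$. The message pair $(M_1,M_2)$ is uniformly distributed on $\mathcal M_1\times\mathcal M_2$, the channel inputs are $\boldsymbol x_1^n(M_1)$ and $\boldsymbol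 x_2^n(M_2,c(M_1))$, the outputs are $\boldsymbol Y_1^n,\boldsymbol Y_2^n,\boldsymbol Z^n$, and $\hat M_j=\hat m_j(\boldsymbol Y_j^n)$. For $\boldsymbol z^n\in\mathcal Z^n$ let $T_{\boldsymbol z^n}(z)=\frac1n|\{i:z_i=z\}|$ be its type, and let $\|P-Q\|_{TV}=\frac12\sum_z|P(z)-Q(z)|$. The rates $(R_1,R_2,R_c)$ are achievable with interference type $G_Z$, a probability distribution on $\mathcal Z$, if there is a sequence of $(n,2^{nR_1},2^{nR_2},2^{nR_c})$-codes such that, as $n\to\infty$, $\Pr\big((\hat M_1,\hat M_2)\neq(M_1,M_2)\big)\to0$ and $\Pr\big(\|T_{\boldsymbol Z^n}-G_Z\|_{TV}\ge\epsilon\big)\to0$ for every $\epsilon>0$. The communication-interference capacity region $\mathcal C$ is the closure, in $\mathbb R^3\times\mathbb R^{\mathcal Z}$, of the set of all tuples $(R_1,R_2,R_c,G_Z)$ such that $(R_1,R_2,R_c)$ is achievable with $G_Z$. Let $\mathcal R$ be the set of all tuples $(R_1,R_2,R_c,Q_Z)$ for which there exist a finite alphabet $\mathcal U$, a probability mass function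 $P_U$ on $\mathcal U$ and conditional probability mass functions $P_{X_1|U}$, $P_{X_2|U}$ such that, for $(U,X_1,X_2,Y_1,Y_2)\sim P_UP_{X_1|U}P_{X_2|U}P_{Y_1|X_1}P_{Y_2|X_2}$, $$R_1<I(X_1;Y_1),\qquad R_2<[I(X_2;Y_2)-I(U;X_2)]^+,\qquad R_c>I(U;X_1),$$ $$\sum_{u,x_1,x_2}P_U(u)P_{X_1|U}(x_1|u)P_{X_2|U}(x_2|u)P_{Z|X_1,X_2}(z|x_1,x_2)=Q_Z(z)\quad\text{for all }z\in\mathcal Z,$$ where $[x]^+=\max(x,0)$ and mutual information is measured in bits. Then $\operatorname{conv}(\mathcal R)\subseteq\mathcal C$. -/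

import Mathlib

noncomputable section

namespace CommInterf

open scoped BigOperators Topology
open Filter

/-- A probability mass function on a finite alphabet `A` is an element of `stdSimplex ℝ A`; a
conditional pmf `P_{B|A}` (a memoryless channel) is a map from `A` to `stdSimplex ℝ B`. -/
abbrev Channel (A B : Type*) [Fintype B] : Type _ := A → stdSimplex ℝ B

/-- Total variation `½ ∑ₐ |P(a) - Q(a)|`. -/
def tv {A : Type*} [Fintype A] (P Q : A → ℝ) : ℝ :=
  (1 / 2) * ∑ a, |P a - Q a|

open Classical in
/-- The type (empirical distribution) of a sequence `z ∈ Aⁿ`. -/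
def seqType {A : Type*} {n : ℕ} (z : Fin n → A) (a : A) : ℝ :=
  (1 / (n : ℝ)) * ∑ i, if z i = a then 1 else 0

/-- Mutual information, in bits, of a pair with joint pmf `p`. A term with `p a b = 0` is `0`;
if `p a b > 0` then both marginals are positive. -/
def mutualInfo {A B : Type*} [Fintype A] [Fintype B] (p : A → B → ℝ) : ℝ :=
  ∑ a, ∑ b, p a b * Real.logb 2 (p a b / ((∑ b', p a b') * (∑ a', p a' b)))

/-- Probability of the event `E` when the outcome `ω` has probability `p ω`. -/
def prob {Ω : Type*} [Fintype Ω] (p : Ω → ℝ) (E : Set Ω) : ℝ :=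
  ∑ ω, E.indicator p ω

/-- The message set, with `⌈2^{nR}⌉` elements. -/
abbrev Msg (n : ℕ) (R : ℝ) : Type := Fin ⌈(2 : ℝ) ^ ((n : ℝ) * R)⌉₊

/-- The set of coordination messages, with `⌊2^{nR}⌋` elements. -/
abbrev CoordMsg (n : ℕ) (R : ℝ) : Type := Fin ⌊(2 : ℝ) ^ ((n : ℝ) * R)⌋₊

/-- An `(n, 2^{nR₁}, 2^{nR₂}, 2^{nR_c})`-code. The decoder output `none` is the error symbol. -/
structure Code (X₁ X₂ Y₁ Y₂ : Type*) (n : ℕ) (R₁ R₂ Rc : ℝ) where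
  enc₁ : Msg n R₁ → Fin n → X₁
  enc₂ : Msg n R₂ → CoordMsg n Rc → Fin n → X₂
  coord : Msg n R₁ → CoordMsg n Rc
  dec₁ : (Fin n → Y₁) → Option (Msg n R₁)
  dec₂ : (Fin n → Y₂) → Option (Msg n R₂)

/-- Outcomes `(m₁, m₂, y₁ⁿ, y₂ⁿ, zⁿ)`: the two messages and the three channel outputs. -/
abbrev Outcome (Y₁ Y₂ Z : Type*) (n : ℕ) (R₁ R₂ : ℝ) : Type _ :=
  Msg n R₁ × Msg n R₂ × (Fin n → Y₁) × (Fin n → Y₂) × (Fin n → Z)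

/-- The joint law of the messages and the channel outputs induced by a code: the message pair is
uniform, Encoder 1 sends `enc₁ m₁`, Encoder 2 sends `enc₂ m₂ (coord m₁)`, and the channel
`P_{Y₁,Y₂,Z|X₁,X₂} = P_{Y₁|X₁} P_{Y₂|X₂} P_{Z|X₁,X₂}` is used `n` times without memory. -/
def Code.law {X₁ X₂ Y₁ Y₂ Z : Type*} [Fintype Y₁] [Fintype Y₂] [Fintype Z]
    {n : ℕ} {R₁ R₂ Rc : ℝ} (c : Code X₁ X₂ Y₁ Y₂ n R₁ R₂ Rc)
    (W₁ : Channel X₁ Y₁) (W₂ : Channel X₂ Y₂) (WZ : Channel (X₁ × X₂) Z) :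
    Outcome Y₁ Y₂ Z n R₁ R₂ → ℝ :=
  fun (m₁, m₂, y₁, y₂, z) =>
    1 / ((Fintype.card (Msg n R₁) : ℝ) * (Fintype.card (Msg n R₂) : ℝ)) *
      ∏ i, W₁ (c.enc₁ m₁ i) (y₁ i) * W₂ (c.enc₂ m₂ (c.coord m₁) i) (y₂ i) *
        WZ (c.enc₁ m₁ i, c.enc₂ m₂ (c.coord m₁) i) (z i)

/-- The event `(M̂₁, M̂₂) ≠ (M₁, M₂)`. -/
def Code.errorEvent {X₁ X₂ Y₁ Y₂ : Type*} (Z : Type*) {n : ℕ} {R₁ R₂ Rc : ℝ}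
    (c : Code X₁ X₂ Y₁ Y₂ n R₁ R₂ Rc) : Set (Outcome Y₁ Y₂ Z n R₁ R₂) :=
  {ω | match ω with
    | (m₁, m₂, y₁, y₂, _) => c.dec₁ y₁ ≠ some m₁ ∨ c.dec₂ y₂ ≠ some m₂}

/-- The event that the type of the interference is at total variation at least `ε` from `G`. -/
def interferenceEvent {Y₁ Y₂ Z : Type*} [Fintype Z] {n : ℕ} {R₁ R₂ : ℝ} (G : Z → ℝ) (ε : ℝ) :
    Set (Outcome Y₁ Y₂ Z n R₁ R₂) :=
  {ω | match ω with
    | (_, _, _, _, z) => ε ≤ tv (seqType z) G}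

/-- The rates `(R₁, R₂, R_c)` are achievable with interference type `G`: some sequence of codes
has vanishing error probability, and the type of its interference converges to `G` in
probability in total variation. -/
def Achievable {X₁ X₂ Y₁ Y₂ Z : Type*} [Fintype Y₁] [Fintype Y₂] [Fintype Z]
    (W₁ : Channel X₁ Y₁) (W₂ : Channel X₂ Y₂) (WZ : Channel (X₁ × X₂) Z)
    (R₁ R₂ Rc : ℝ) (G : Z → ℝ) : Prop :=
  G ∈ stdSimplex ℝ Z ∧
    ∃ c : (n : ℕ) → Code X₁ X₂ Y₁ Y₂ n R₁ R₂ Rc,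
      Tendsto (fun n => prob ((c n).law W₁ W₂ WZ) ((c n).errorEvent Z)) atTop (𝓝 0) ∧
      ∀ ε : ℝ, 0 < ε →
        Tendsto (fun n => prob ((c n).law W₁ W₂ WZ) (interferenceEvent G ε)) atTop (𝓝 0)

/-- The communication-interference capacity region: the closure of the set of achievable
tuples `(R₁, R₂, R_c, G)`. -/
def capacityRegion {X₁ X₂ Y₁ Y₂ Z : Type*} [Fintype Y₁] [Fintype Y₂] [Fintype Z]
    (W₁ : Channel X₁ Y₁) (W₂ : Channel X₂ Y₂) (WZ : Channel (X₁ × X₂) Z) :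
    Set (ℝ × ℝ × ℝ × (Z → ℝ)) :=
  closure {(R₁, R₂, Rc, G) | Achievable W₁ W₂ WZ R₁ R₂ Rc G}

/-- The joint pmf `P_A P_{B|A}` of a pair. -/
def jointPmf {A B : Type*} [Fintype B] (P : A → ℝ) (W : Channel A B) (a : A) (b : B) : ℝ :=
  P a * W a b

/-- The output marginal `∑ₐ P_A(a) P_{B|A}(·|a)`. -/
def outPmf {A B : Type*} [Fintype A] [Fintype B] (P : A → ℝ) (W : Channel A B) (b : B) : ℝ :=
  ∑ a, P a * W a b

/-- The single-letter region `R`: the auxiliary variable `U` ranges over all finite alphabets,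
taken as `Fin k` without loss of generality, and `X₁ - U - X₂` is a Markov chain. -/
def singleLetterRegion {X₁ X₂ Y₁ Y₂ Z : Type*} [Fintype X₁] [Fintype X₂]
    [Fintype Y₁] [Fintype Y₂] [Fintype Z]
    (W₁ : Channel X₁ Y₁) (W₂ : Channel X₂ Y₂) (WZ : Channel (X₁ × X₂) Z) :
    Set (ℝ × ℝ × ℝ × (Z → ℝ)) :=
  {(R₁, R₂, Rc, Q) | ∃ (k : ℕ) (PU : stdSimplex ℝ (Fin k))
      (V₁ : Channel (Fin k) X₁) (V₂ : Channel (Fin k) X₂),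
    R₁ < mutualInfo (jointPmf (outPmf PU V₁) W₁) ∧
    R₂ < max (mutualInfo (jointPmf (outPmf PU V₂) W₂) - mutualInfo (jointPmf PU V₂)) 0 ∧
    mutualInfo (jointPmf PU V₁) < Rc ∧
    ∀ z, ∑ u, ∑ x₁, ∑ x₂, PU u * V₁ u x₁ * V₂ u x₂ * WZ (x₁, x₂) z = Q z}

end CommInterf

end

/-!
The inclusion is proved by random coding. A point of the convex hull is an average, over a
time-sharing variable `j`, of points of the single-letter region. The sequence of the `j`'s is drawn
independently and is known to all terminals, so that given this sequence all letters are independent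
and averaged over it they are identically distributed; Chebyshev's inequality then controls every
normalised sum of information densities (`ev_ind_sum_ge_le`) and the type of the interference
(`ev_typeDev_le`).

The codes are analysed for a single use of an arbitrary channel (`CodingLaw.exists_code`), which is
then applied to the memoryless extensions. The coordination codewords `u c` are independent. A message
of user 1 first receives a uniform coordination message `c` and then a codeword drawn from
`P_{X₁|U} (u c)`, so coordination is automatic. What needs an argument is that user 1 can still be
decoded: a competitor with another coordination message is independent of the output, and one with
the same coordination message is rare and, if its likelihood ratio given `u c` is at most `γ'`, only
`γ'` times as dangerous; this is where `R_c > I(U;X₁)` enters (`ev_test₁_competitor_le`).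

User 2 has `L` independent codewords for each message and uses one that passes a rejection-sampling
experiment, whose acceptance probability is proportional to the likelihood ratio of the codeword given
`u c`. An accepted codeword then has the law `P_{V|U} (u c)`, up to a factor `L / γ₃` on the
probability of any event (`ev_accepted_le`), and some codeword is accepted if `L` exceeds
`2 ^ (n I(U;V))` by a slowly growing factor (`ev_forall_none_le`). As the codeword of user 1 is
independent of the experiment given `u c`, the triple `(X₁, U, X₂)` behaves like the single-letter
law without any appeal to joint typicality. The positive part in the bound on `R₂` is obtained from an
auxiliary letter `V`: it is `X₂` itself where communication pays, and a constant elsewhere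
(`familyLaw`).

All probabilities are finite sums, written as nested expectations `ev`.
-/

noncomputable section

namespace CommInterf

open scoped BigOperators Topology
open Filter

/-! ### Expectations with respect to pmfs on finite alphabets -/

/-- The expectation of `f` under the pmf `p`. Nested expectations `ev p fun a => ev (κ a) f` stand
for sampling `a` from `p` and then `b` from the conditional pmf `κ a`. -/
def ev {A : Type*} [Fintype A] (p : stdSimplex ℝ A) (f : A → ℝ) : ℝ := ∑ a, p a * f a

open Classical in
/-- The indicator of a proposition. -/
def ind (P : Prop) : ℝ := if P then 1 else 0

section Indicator

lemma ind_of {P : Prop} (h : P) : ind P = 1 := by simp [ind, h]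

lemma ind_of_not {P : Prop} (h : ¬P) : ind P = 0 := by simp [ind, h]

lemma ind_nonneg (P : Prop) : 0 ≤ ind P := by
  unfold ind; split_ifs <;> norm_num

lemma ind_le_one (P : Prop) : ind P ≤ 1 := by
  unfold ind; split_ifs <;> norm_num

lemma ind_mono {P Q : Prop} (h : P → Q) : ind P ≤ ind Q := by
  by_cases hP : P
  · rw [ind_of hP, ind_of (h hP)]
  · rw [ind_of_not hP]; exact ind_nonneg _

lemma ind_or_le (P Q : Prop) : ind (P ∨ Q) ≤ ind P + ind Q := by
  by_cases hP : P
  · rw [ind_of hP]; linarith [ind_le_one (P ∨ Q), ind_nonneg Q]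
  · rw [ind_of_not hP, zero_add]; exact ind_mono fun h => h.resolve_left hP

lemma ind_exists_le {ι : Type*} (s : Finset ι) (P : ι → Prop) :
    ind (∃ i ∈ s, P i) ≤ ∑ i ∈ s, ind (P i) := by
  by_cases h : ∃ i ∈ s, P i
  · obtain ⟨i, hi, hP⟩ := h
    calc ind _ ≤ 1 := ind_le_one _
      _ = ind (P i) := (ind_of hP).symm
      _ ≤ _ := Finset.single_le_sum (f := fun i => ind (P i)) (fun _ _ => ind_nonneg _) hi
  · rw [ind_of_not h]; exact Finset.sum_nonneg fun _ _ => ind_nonneg _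

end Indicator

section Expectation

variable {A B : Type*} [Fintype A] [Fintype B] (p : stdSimplex ℝ A)

lemma ev_mono_of_pos {f g : A → ℝ} (h : ∀ a, 0 < p a → f a ≤ g a) : ev p f ≤ ev p g := by
  refine Finset.sum_le_sum fun a _ => ?_
  rcases (stdSimplex.zero_le p a).eq_or_lt with h0 | h0
  · simp [← h0]
  · exact mul_le_mul_of_nonneg_left (h a h0) h0.le

lemma ev_mono {f g : A → ℝ} (h : ∀ a, f a ≤ g a) : ev p f ≤ ev p g :=
  ev_mono_of_pos p fun a _ => h a

@[simp] lemma ev_const (c : ℝ) : ev p (fun _ => c) = c := by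
  simp [ev, ← Finset.sum_mul]

lemma ev_nonneg {f : A → ℝ} (h : ∀ a, 0 ≤ f a) : 0 ≤ ev p f := by
  simpa using ev_mono p h

lemma ev_le_const {f : A → ℝ} {c : ℝ} (h : ∀ a, f a ≤ c) : ev p f ≤ c := by
  simpa using ev_mono p h

lemma ev_add (f g : A → ℝ) : ev p (fun a => f a + g a) = ev p f + ev p g := by
  simp [ev, mul_add, Finset.sum_add_distrib]

lemma ev_sub (f g : A → ℝ) : ev p (fun a => f a - g a) = ev p f - ev p g := by
  simp [ev, mul_sub, Finset.sum_sub_distrib]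

lemma ev_const_mul (c : ℝ) (f : A → ℝ) : ev p (fun a => c * f a) = c * ev p f := by
  simp only [ev, Finset.mul_sum]
  exact Finset.sum_congr rfl fun a _ => by ring

lemma ev_sum {ι : Type*} (s : Finset ι) (f : ι → A → ℝ) :
    ev p (fun a => ∑ i ∈ s, f i a) = ∑ i ∈ s, ev p (f i) := by
  simp only [ev, Finset.mul_sum]
  exact Finset.sum_comm

lemma ev_comm (q : stdSimplex ℝ B) (f : A → B → ℝ) :
    ev p (fun a => ev q fun b => f a b) = ev q fun b => ev p fun a => f a b := by
  simp only [ev, Finset.mul_sum]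
  rw [Finset.sum_comm]
  exact Finset.sum_congr rfl fun _ _ => Finset.sum_congr rfl fun _ _ => by ring

/-- The probabilistic method: some outcome is at most the average. -/
lemma exists_le_of_ev_le {f : A → ℝ} {c : ℝ} (h : ev p f ≤ c) : ∃ a, f a ≤ c := by
  by_contra! hc
  have hpos : ∃ a, 0 < p a := by
    by_contra! h0
    have := stdSimplex.sum_eq_one p
    rw [Finset.sum_eq_zero fun a _ => le_antisymm (h0 a) (stdSimplex.zero_le p a)] at this
    norm_num at this
  obtain ⟨a, ha⟩ := hpos
  have : ev p (fun _ => c) < ev p f :=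
    Finset.sum_lt_sum
      (fun b _ => mul_le_mul_of_nonneg_left (hc b).le (stdSimplex.zero_le p b))
      ⟨a, Finset.mem_univ _, mul_lt_mul_of_pos_left (hc a) ha⟩
  rw [ev_const] at this
  linarith

/-- The joint pmf of a pair `(a, b)` with `a ∼ p` and `b ∼ κ a`. -/
def pairPmf (κ : A → stdSimplex ℝ B) : stdSimplex ℝ (A × B) :=
  ⟨fun x => p x.1 * κ x.1 x.2,
    fun x => mul_nonneg (stdSimplex.zero_le _ _) (stdSimplex.zero_le _ _), by
      rw [Fintype.sum_prod_type]
      simp [← Finset.mul_sum]⟩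

lemma pairPmf_apply (κ : A → stdSimplex ℝ B) (x : A × B) :
    pairPmf p κ x = p x.1 * κ x.1 x.2 := rfl

lemma ev_pairPmf (κ : A → stdSimplex ℝ B) (f : A × B → ℝ) :
    ev (pairPmf p κ) f = ev p fun a => ev (κ a) fun b => f (a, b) := by
  simp only [ev, pairPmf_apply, Fintype.sum_prod_type, Finset.mul_sum, mul_assoc]

/-- The uniform pmf on a nonempty finite set. -/
def unifPmf (C : Type*) [Fintype C] [Nonempty C] : stdSimplex ℝ C :=
  ⟨fun _ => 1 / (Fintype.card C : ℝ), fun _ => by positivity, by simp⟩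

lemma ev_unifPmf {C : Type*} [Fintype C] [Nonempty C] (f : C → ℝ) :
    ev (unifPmf C) f = 1 / (Fintype.card C : ℝ) * ∑ c, f c := by
  rw [Finset.mul_sum]; rfl

end Expectation

lemma pos_of_pairPmf_pos {A B : Type*} [Fintype A] [Fintype B]
    {p : stdSimplex ℝ A} {κ : A → stdSimplex ℝ B} {a : A × B} (h : 0 < pairPmf p κ a) :
    0 < p a.1 ∧ 0 < κ a.1 a.2 := by
  rw [pairPmf_apply] at h
  constructor
  · exact (stdSimplex.zero_le _ _).lt_of_ne' fun h0 => by simp [h0] at h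
  · exact (stdSimplex.zero_le _ _).lt_of_ne' fun h0 => by simp [h0] at h

/-- Markov's inequality for a density of mean at most `1`. -/
lemma ev_ind_lt_le {A : Type*} [Fintype A] (p : stdSimplex ℝ A) {d : A → ℝ} (hd : ∀ a, 0 ≤ d a)
    (h : ev p d ≤ 1) {γ : ℝ} (hγ : 0 < γ) : ev p (fun a => ind (γ < d a)) ≤ 1 / γ := by
  calc ev p (fun a => ind (γ < d a)) ≤ ev p fun a => 1 / γ * d a := by
        refine ev_mono p fun a => ?_
        by_cases ha : γ < d a
        · rw [ind_of ha, one_div, inv_mul_eq_div, one_le_div hγ]; exact ha.le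
        · rw [ind_of_not ha]; exact mul_nonneg (by positivity) (hd a)
    _ ≤ 1 / γ := by
        rw [ev_const_mul]; exact mul_le_of_le_one_right (by positivity) h

/-- A relative entropy is nonnegative. -/
lemma ev_logb_nonneg {A : Type*} [Fintype A] (p : stdSimplex ℝ A) (r : A → ℝ)
    (hr : ∀ a, 0 < p a → 0 < r a) (h : ev p (fun a => (r a)⁻¹) ≤ 1) :
    0 ≤ ev p fun a => Real.logb 2 (r a) := by
  have h1 : ev p (fun a => (1 / Real.log 2) * (1 - (r a)⁻¹)) ≤ ev p fun a => Real.logb 2 (r a) := by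
    refine ev_mono_of_pos p fun a ha => ?_
    rw [Real.logb, div_eq_mul_one_div (Real.log (r a)), mul_comm (Real.log (r a))]
    exact mul_le_mul_of_nonneg_left (Real.one_sub_inv_le_log_of_pos (hr a ha))
      (by have := Real.log_pos one_lt_two; positivity)
  rw [ev_const_mul, ev_sub, ev_const] at h1
  exact (mul_nonneg (by have := Real.log_pos one_lt_two; positivity) (by linarith)).trans h1

/-! ### Product pmfs -/

section Product

variable {ι A B : Type*} [Fintype ι] [DecidableEq ι] [Fintype A] [Fintype B]

/-- The law of independent `w i ∼ p i`. -/
def piPmf (p : ι → stdSimplex ℝ A) : stdSimplex ℝ (ι → A) :=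
  ⟨fun w => ∏ i, p i (w i), fun _ => Finset.prod_nonneg fun _ _ => stdSimplex.zero_le _ _, by
    rw [← Fintype.prod_sum (fun i a => p i a)]
    simp⟩

lemma piPmf_apply (p : ι → stdSimplex ℝ A) (w : ι → A) : piPmf p w = ∏ i, p i (w i) := rfl

lemma pos_of_piPmf_pos {p : ι → stdSimplex ℝ A} {w : ι → A} (h : 0 < piPmf p w) (i : ι) :
    0 < p i (w i) :=
  (stdSimplex.zero_le _ _).lt_of_ne' fun h0 =>
    h.ne' (Finset.prod_eq_zero (Finset.mem_univ i) h0)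

/-- Expectations factorise over independent coordinates. -/
lemma ev_piPmf_prod (p : ι → stdSimplex ℝ A) (F : ι → A → ℝ) :
    ev (piPmf p) (fun w => ∏ i, F i (w i)) = ∏ i, ev (p i) (F i) := by
  simp only [ev, piPmf_apply, ← Finset.prod_mul_distrib]
  rw [Fintype.prod_sum]

lemma ev_piPmf_eval (p : ι → stdSimplex ℝ A) (i : ι) (g : A → ℝ) :
    ev (piPmf p) (fun w => g (w i)) = ev (p i) g := by
  have h := ev_piPmf_prod p fun k a => if k = i then g a else 1
  have h2 : ∀ k, ev (p k) (fun a => if k = i then g a else 1) = if k = i then ev (p i) g else 1 := by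
    intro k
    by_cases hk : k = i
    · subst hk; simp
    · simp [hk]
  simp only [h2, Finset.prod_ite_eq', Finset.mem_univ, if_true] at h
  exact h

lemma ev_piPmf_mul (p : ι → stdSimplex ℝ A) {i k : ι} (hik : i ≠ k) (g h : A → ℝ) :
    ev (piPmf p) (fun w => g (w i) * h (w k)) = ev (p i) g * ev (p k) h := by
  have key := ev_piPmf_prod p fun l a => (if l = i then g a else 1) * (if l = k then h a else 1)
  have h2 : ∀ l, ev (p l) (fun a => (if l = i then g a else 1) * (if l = k then h a else 1)) =
      (if l = i then ev (p i) g else 1) * (if l = k then ev (p k) h else 1) := by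
    intro l
    by_cases hi : l = i
    · subst hi; simp [hik]
    · by_cases hk : l = k
      · subst hk; simp [hi]
      · simp [hi, hk]
  simp only [h2, Finset.prod_mul_distrib, Finset.prod_ite_eq', Finset.mem_univ, if_true] at key
  exact key

open Classical in
lemma ev_piPmf_eval₂ (p : ι → stdSimplex ℝ A) {i k : ι} (hik : i ≠ k) (F : A → A → ℝ) :
    ev (piPmf p) (fun w => F (w i) (w k)) = ev (p i) fun a => ev (p k) fun b => F a b := by
  have hF : ∀ a b, F a b = ∑ x, ∑ y, F x y * ((if a = x then 1 else 0) * (if b = y then 1 else 0)) := by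
    intro a b
    simp
  rw [show (fun w : ι → A => F (w i) (w k)) = fun w => ∑ x, ∑ y, F x y *
      ((if w i = x then 1 else 0) * (if w k = y then 1 else 0)) from funext fun w => hF _ _]
  simp only [ev_sum, ev_const_mul]
  have hm : ∀ x y, ev (piPmf p) (fun w => (if w i = x then (1 : ℝ) else 0) *
      (if w k = y then 1 else 0)) = p i x * p k y := by
    intro x y
    rw [ev_piPmf_mul p hik (fun a => if a = x then 1 else 0) (fun a => if a = y then 1 else 0)]
    simp [ev]
  simp only [hm]
  simp only [ev, Finset.mul_sum]
  exact Finset.sum_congr rfl fun _ _ => Finset.sum_congr rfl fun _ _ => by ring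

/-- Drawing two sequences letter by letter is drawing the sequence of pairs. -/
lemma ev_piPmf_ev_piPmf (p : ι → stdSimplex ℝ A) (κ : ι → A → stdSimplex ℝ B)
    (F : (ι → A) → (ι → B) → ℝ) :
    ev (piPmf p) (fun a => ev (piPmf fun i => κ i (a i)) fun b => F a b) =
      ev (piPmf fun i => pairPmf (p i) (κ i)) fun w => F (fun i => (w i).1) fun i => (w i).2 := by
  simp only [ev, piPmf_apply, pairPmf_apply, Finset.mul_sum]
  rw [← Fintype.sum_prod_type' (f := fun (a : ι → A) (b : ι → B) =>
    (∏ i, p i (a i)) * ((∏ i, κ i (a i) (b i)) * F a b))]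
  refine (Fintype.sum_equiv (Equiv.arrowProdEquivProdArrow ι (fun _ => A) (fun _ => B)) _ _ ?_).symm
  intro w
  simp only [Equiv.arrowProdEquivProdArrow, Equiv.coe_fn_mk, Finset.prod_mul_distrib, mul_assoc]

/-- The variance of a sum of independent identically distributed centred variables. -/
lemma ev_piPmf_sq_sum (p : stdSimplex ℝ A) (f : A → ℝ) (hf : ev p f = 0) :
    ev (piPmf fun _ : ι => p) (fun w => (∑ i, f (w i)) ^ 2) =
      Fintype.card ι * ev p fun a => f a ^ 2 := by
  simp only [sq, Finset.sum_mul_sum, ev_sum]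
  have : ∀ i k, ev (piPmf fun _ : ι => p) (fun w => f (w i) * f (w k)) =
      if i = k then ev p (fun a => f a * f a) else 0 := by
    intro i k
    by_cases h : i = k
    · subst h
      rw [if_pos rfl, ev_piPmf_eval (fun _ => p) i fun a => f a * f a]
    · rw [ev_piPmf_mul _ h, hf, if_neg h, zero_mul]
  simp [this]

end Product

/-! ### Laws of large numbers -/

section LargeNumbers

variable {Ω : Type*} [Fintype Ω]

/-- Chebyshev's inequality for the upper tail. -/
lemma ev_ind_sum_ge_le (p : stdSimplex ℝ Ω) (f : Ω → ℝ) {t : ℝ} (ht : ev p f < t) {n : ℕ}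
    (hn : 0 < n) :
    ev (piPmf fun _ : Fin n => p) (fun w => ind (n * t ≤ ∑ i, f (w i))) ≤
      (ev p fun a => (f a - ev p f) ^ 2) / (t - ev p f) ^ 2 / n := by
  have hn' : (0 : ℝ) < n := by exact_mod_cast hn
  set μ := ev p f
  have hd : 0 < t - μ := by linarith
  have h1 : ∀ w : Fin n → Ω, ind (n * t ≤ ∑ i, f (w i)) ≤
      1 / (n * (t - μ)) ^ 2 * (∑ i, (f (w i) - μ)) ^ 2 := by
    intro w
    by_cases h : n * t ≤ ∑ i, f (w i)
    · rw [ind_of h, one_div, inv_mul_eq_div, one_le_div (by positivity)]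
      refine pow_le_pow_left₀ (by positivity) ?_ 2
      simp only [Finset.sum_sub_distrib, Finset.sum_const, Finset.card_univ, Fintype.card_fin,
        nsmul_eq_mul]
      linarith
    · rw [ind_of_not h]; positivity
  refine (ev_mono _ h1).trans (le_of_eq ?_)
  rw [ev_const_mul, ev_piPmf_sq_sum p (fun a => f a - μ) (by rw [ev_sub, ev_const]; exact sub_self _),
    Fintype.card_fin]
  field_simp

/-- If a positive ratio has mean logarithm below `t`, the product of `n` independent copies exceeds
`2 ^ (n t)` with vanishing probability. -/
lemma ev_ind_lt_prod_le (p : stdSimplex ℝ Ω) (r : Ω → ℝ) (hr : ∀ a, 0 < p a → 0 < r a)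
    {t : ℝ} (ht : ev p (fun a => Real.logb 2 (r a)) < t) :
    ∃ c : ℝ, ∀ n : ℕ, 0 < n → ev (piPmf fun _ : Fin n => p)
      (fun w => ind ((2 : ℝ) ^ (n * t) < ∏ i, r (w i))) ≤ c / n := by
  refine ⟨_, fun n hn => le_trans (ev_mono_of_pos _ fun w hw => ind_mono fun h => ?_)
    (ev_ind_sum_ge_le p _ ht hn)⟩
  have hpos : ∀ i, 0 < r (w i) := fun i => hr _ (pos_of_piPmf_pos hw i)
  rw [← Real.logb_prod _ _ fun i _ => (hpos i).ne',
    Real.le_logb_iff_rpow_le one_lt_two (Finset.prod_pos fun i _ => hpos i)]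
  exact h.le

lemma ev_ind_prod_le_le (p : stdSimplex ℝ Ω) (r : Ω → ℝ) (hr : ∀ a, 0 < p a → 0 < r a)
    {t : ℝ} (ht : t < ev p (fun a => Real.logb 2 (r a))) :
    ∃ c : ℝ, ∀ n : ℕ, 0 < n → ev (piPmf fun _ : Fin n => p)
      (fun w => ind (∏ i, r (w i) ≤ (2 : ℝ) ^ (n * t))) ≤ c / n := by
  have hneg : ev p (fun a => -Real.logb 2 (r a)) < -t := by
    have := ev_const_mul p (-1) fun a => Real.logb 2 (r a)
    simp only [neg_mul, one_mul] at this
    linarith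
  refine ⟨_, fun n hn => le_trans (ev_mono_of_pos _ fun w hw => ind_mono fun h => ?_)
    (ev_ind_sum_ge_le p _ hneg hn)⟩
  have hpos : ∀ i, 0 < r (w i) := fun i => hr _ (pos_of_piPmf_pos hw i)
  rw [Finset.sum_neg_distrib, ← Real.logb_prod _ _ fun i _ => (hpos i).ne']
  have := (Real.logb_le_iff_le_rpow one_lt_two (Finset.prod_pos fun i _ => hpos i)).2 h
  linarith

end LargeNumbers


/-! ### The unique-candidate decoder -/

section Decoder

variable {M Y : Type*}

open Classical in
/-- The decoder that outputs the unique message passing the test `A`, and the error symbol if there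
is no such message or more than one. -/
def decodeUnique (A : M → Y → Prop) (y : Y) : Option M :=
  if h : ∃! m, A m y then some h.choose else none

lemma decodeUnique_eq {A : M → Y → Prop} {y : Y} {m : M} (hm : A m y)
    (huniq : ∀ m', m' ≠ m → ¬A m' y) : decodeUnique A y = some m := by
  have h : ∃! m, A m y := ⟨m, hm, fun m' hm' => by_contra fun hne => huniq m' hne hm'⟩
  rw [decodeUnique, dif_pos h, h.unique h.choose_spec.1 hm]

lemma ind_decodeUnique_ne_le [Fintype M] [DecidableEq M] (A : M → Y → Prop) (y : Y) (m : M) :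
    ind (decodeUnique A y ≠ some m) ≤
      ind (¬A m y) + ∑ m' ∈ Finset.univ.erase m, ind (A m' y) := by
  refine le_trans (ind_mono fun h => ?_)
    ((ind_or_le (¬A m y) (∃ m' ∈ Finset.univ.erase m, A m' y)).trans
      (add_le_add le_rfl (ind_exists_le _ _)))
  by_contra! hc
  exact h (decodeUnique_eq hc.1 fun m' hne => hc.2 m' (by simp [hne]))

end Decoder

/-! ### Random codes for a single use of a channel -/

/-- The pmfs from which random codes are drawn, and the densities used by the decoders: `U ∼ pU` is
the coordination variable, `X₁ ∼ q₁ U` the first input, `V ∼ qV U` the auxiliary codeword of the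
second user and `X₂ ∼ q₂ U V` the second input. The pmfs `r₁` and `rV` stand for the marginals of
`X₁` and `V`; a decoder compares the densities `d₁` and `d₂`, which stand for the likelihood ratios
`P_{Y₁|X₁} / P_{Y₁}` and `P_{Y₂|V} / P_{Y₂}`, with a threshold. The channels do not enter: the analysis
of a false candidate only uses that the densities have mean at most `1`. -/
structure CodingLaw (U V X₁ X₂ Y₁ Y₂ : Type*) [Fintype U] [Fintype V] [Fintype X₁] [Fintype X₂] where
  pU : stdSimplex ℝ U
  q₁ : Channel U X₁
  qV : Channel U V
  q₂ : U → Channel V X₂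
  r₁ : stdSimplex ℝ X₁
  rV : stdSimplex ℝ V
  d₁ : X₁ → Y₁ → ℝ
  d₂ : V → Y₂ → ℝ
  d₁_nonneg : ∀ x y, 0 ≤ d₁ x y
  d₂_nonneg : ∀ v y, 0 ≤ d₂ v y
  ev_q₁_le : ∀ x, ev pU (fun u => q₁ u x) ≤ r₁ x
  ev_d₁_le : ∀ y, ev r₁ (fun x => d₁ x y) ≤ 1
  ev_d₂_le : ∀ y, ev rV (fun v => d₂ v y) ≤ 1

namespace CodingLaw

variable {U V X₁ X₂ Y₁ Y₂ : Type*} [Fintype U] [Fintype V] [Fintype X₁] [Fintype X₂]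
  (D : CodingLaw U V X₁ X₂ Y₁ Y₂)

lemma ev_pU_q₁_le {f : X₁ → ℝ} (hf : ∀ x, 0 ≤ f x) :
    (ev D.pU fun u => ev (D.q₁ u) f) ≤ ev D.r₁ f := by
  have : (ev D.pU fun u => ev (D.q₁ u) f) = ∑ x, ev D.pU (fun u => D.q₁ u x) * f x := by
    simp only [ev, Finset.mul_sum, Finset.sum_mul]
    rw [Finset.sum_comm]
    exact Finset.sum_congr rfl fun _ _ => Finset.sum_congr rfl fun _ _ => by ring
  rw [this]
  exact Finset.sum_le_sum fun x _ => mul_le_mul_of_nonneg_right (D.ev_q₁_le x) (hf x)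

/-! ### Decoding of user 1 -/

section UserOne

variable {C M₁ : Type*} [Fintype C] [DecidableEq C] [Nonempty C] [Fintype M₁] [DecidableEq M₁]

/-- The law of the coordination codebook: independent codewords from `pU`. -/
def coordLaw (C : Type*) [Fintype C] [DecidableEq C] : stdSimplex ℝ (C → U) := piPmf fun _ => D.pU

/-- Given the coordination codebook `u`, each message of user 1 independently receives a uniform
coordination message `c` and a codeword drawn from `q₁ (u c)`. -/
def bookLaw₁ (M₁ : Type*) [Fintype M₁] [DecidableEq M₁] (u : C → U) : stdSimplex ℝ (M₁ → C × X₁) :=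
  piPmf fun _ => pairPmf (unifPmf C) fun c => D.q₁ (u c)

/-- A candidate message of user 1 passes if its codeword is likely for the output `y`, and not too
likely under its coordination codeword. -/
def Test₁ (γ₁ γ' : ℝ) (u : U) (x : X₁) (y : Y₁) : Prop :=
  γ₁ < D.d₁ x y ∧ D.q₁ u x ≤ γ' * D.r₁ x

/-- Averaged over the codebooks, the coordination codeword and the codeword of a message have the
single-letter law. -/
lemma ev_coordLaw_bookLaw₁ (m : M₁) (F : U → X₁ → ℝ) :
    (ev (D.coordLaw C) fun u => ev (D.bookLaw₁ M₁ u) fun s => F (u (s m).1) (s m).2) =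
      ev D.pU fun u => ev (D.q₁ u) fun x => F u x := by
  have h : ∀ u : C → U, (ev (D.bookLaw₁ M₁ u) fun s => F (u (s m).1) (s m).2) =
      ev (unifPmf C) fun c => ev (D.q₁ (u c)) fun x => F (u c) x := by
    intro u
    rw [bookLaw₁, ev_piPmf_eval _ m (fun a : C × X₁ => F (u a.1) a.2), ev_pairPmf]
  simp only [h]
  rw [ev_comm]
  have h2 : ∀ c : C, (ev (D.coordLaw C) fun u => ev (D.q₁ (u c)) fun x => F (u c) x) =
      ev D.pU fun u => ev (D.q₁ u) fun x => F u x := fun c =>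
    ev_piPmf_eval (fun _ : C => D.pU) c fun u => ev (D.q₁ u) fun x => F u x
  simp only [h2, ev_const]

/-- A competitor that shares the coordination message is not independent of the output; the second
half of the test bounds the price by `γ'`. -/
lemma ev_q₁_test₁_le {γ₁ γ' : ℝ} (hγ₁ : 0 < γ₁) (hγ' : 0 < γ') (u : U) (y : Y₁) :
    ev (D.q₁ u) (fun x => ind (D.Test₁ γ₁ γ' u x y)) ≤ γ' / γ₁ := by
  calc ev (D.q₁ u) (fun x => ind (D.Test₁ γ₁ γ' u x y))
      ≤ γ' * ev D.r₁ (fun x => ind (γ₁ < D.d₁ x y)) := by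
        simp only [ev, Finset.mul_sum]
        refine Finset.sum_le_sum fun x _ => ?_
        by_cases hx : D.Test₁ γ₁ γ' u x y
        · rw [ind_of hx, ind_of hx.1]; linarith [hx.2]
        · rw [ind_of_not hx, mul_zero]
          exact mul_nonneg hγ'.le (mul_nonneg (stdSimplex.zero_le _ _) (ind_nonneg _))
    _ ≤ γ' * (1 / γ₁) := mul_le_mul_of_nonneg_left
        (ev_ind_lt_le _ (fun x => D.d₁_nonneg x y) (D.ev_d₁_le y) hγ₁) hγ'.le
    _ = γ' / γ₁ := by ring

/-- The probability that a given competitor passes the first test: it is independent of the output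
unless it shares the coordination message, which has probability `1 / |C|`. -/
lemma ev_test₁_competitor_le [Fintype Y₁] (W₁ : Channel X₁ Y₁) {γ₁ γ' : ℝ} (hγ₁ : 0 < γ₁) (hγ' : 0 < γ')
    {m m' : M₁} (hm : m ≠ m') :
    (ev (D.coordLaw C) fun u => ev (D.bookLaw₁ M₁ u) fun s =>
      ev (W₁ (s m).2) fun y => ind (D.Test₁ γ₁ γ' (u (s m').1) (s m').2 y)) ≤
      1 / γ₁ + γ' / (Fintype.card C * γ₁) := by
  set Φ : (C → U) → C → C → ℝ := fun u c c' => ev (D.q₁ (u c)) fun x => ev (D.q₁ (u c')) fun x' =>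
    ev (W₁ x) fun y => ind (D.Test₁ γ₁ γ' (u c') x' y) with hΦ
  have h : ∀ u : C → U, (ev (D.bookLaw₁ M₁ u) fun s =>
      ev (W₁ (s m).2) fun y => ind (D.Test₁ γ₁ γ' (u (s m').1) (s m').2 y)) =
      ev (unifPmf C) fun c => ev (unifPmf C) fun c' => Φ u c c' := by
    intro u
    rw [bookLaw₁, ev_piPmf_eval₂ _ hm (fun a b : C × X₁ => ev (W₁ a.2) fun y =>
      ind (D.Test₁ γ₁ γ' (u b.1) b.2 y)), ev_pairPmf]
    refine congrArg _ (funext fun c => ?_)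
    simp only [ev_pairPmf]
    rw [ev_comm]
  simp only [h]
  rw [ev_comm]
  simp only [ev_comm (D.coordLaw C)]
  have hsame : ∀ c, ev (D.coordLaw C) (fun u => Φ u c c) ≤ γ' / γ₁ := fun c =>
    ev_le_const _ fun u => ev_le_const _ fun x => by
      rw [ev_comm]
      exact ev_le_const _ fun y => D.ev_q₁_test₁_le hγ₁ hγ' (u c) y
  have hdiff : ∀ c c', c ≠ c' → ev (D.coordLaw C) (fun u => Φ u c c') ≤ 1 / γ₁ := by
    intro c c' hc
    rw [hΦ, coordLaw, ev_piPmf_eval₂ (fun _ : C => D.pU) hc (fun a b => ev (D.q₁ a) fun x =>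
      ev (D.q₁ b) fun x' => ev (W₁ x) fun y => ind (D.Test₁ γ₁ γ' b x' y))]
    refine ev_le_const _ fun a => ?_
    rw [ev_comm]
    refine ev_le_const _ fun x => ?_
    have : (ev D.pU fun b => ev (D.q₁ b) fun x' => ev (W₁ x) fun y => ind (D.Test₁ γ₁ γ' b x' y)) ≤
        ev D.pU fun b => ev (D.q₁ b) fun x' => ev (W₁ x) fun y => ind (γ₁ < D.d₁ x' y) :=
      ev_mono _ fun b => ev_mono _ fun x' => ev_mono _ fun y => ind_mono And.left
    refine this.trans ((D.ev_pU_q₁_le fun x' => ev_nonneg _ fun y => ind_nonneg _).trans ?_)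
    rw [ev_comm]
    exact ev_le_const _ fun y => ev_ind_lt_le _ (fun x => D.d₁_nonneg x y) (D.ev_d₁_le y) hγ₁
  refine ev_le_const _ fun c => ?_
  have hle : ∀ c', ev (D.coordLaw C) (fun u => Φ u c c') ≤
      1 / γ₁ + if c = c' then γ' / γ₁ else 0 := by
    intro c'
    by_cases hc : c = c'
    · subst hc
      rw [if_pos rfl]
      linarith [hsame c, show 0 ≤ 1 / γ₁ by positivity]
    · rw [if_neg hc, add_zero]; exact hdiff c c' hc
  refine (ev_mono _ hle).trans (le_of_eq ?_)
  rw [ev_add, ev_const, ev_unifPmf]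
  simp only [Finset.sum_ite_eq, Finset.mem_univ, if_true]
  field_simp

end UserOne

end CodingLaw


namespace CodingLaw

variable {U V X₁ X₂ Y₁ Y₂ : Type*} [Fintype U] [Fintype V] [Fintype X₁] [Fintype X₂]
  (D : CodingLaw U V X₁ X₂ Y₁ Y₂)

/-! ### Covering and decoding of user 2 -/

section UserTwo

variable {C M₂ : Type*} [Fintype C] [DecidableEq C] [Fintype M₂] [DecidableEq M₂]

open Classical in
/-- The probability with which the codeword `v` is accepted for the coordination codeword `u`: it is
proportional to the likelihood ratio of `v` where that is at most `γ₃`, so that an accepted codeword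
has the law `qV u` restricted to those `v`. -/
def accProb (γ₃ : ℝ) (u : U) (v : V) : ℝ :=
  if D.qV u v ≤ γ₃ * D.rV v then D.qV u v / (γ₃ * D.rV v) else 0

/-- The probability of a likelihood ratio at most `γ₃`. -/
def accMass (γ₃ : ℝ) (u : U) : ℝ := ev (D.qV u) fun v => ind (D.qV u v ≤ γ₃ * D.rV v)

variable {γ₃ : ℝ}

lemma accProb_nonneg (hγ₃ : 0 < γ₃) (u : U) (v : V) : 0 ≤ D.accProb γ₃ u v := by
  unfold accProb
  split_ifs
  · exact div_nonneg (stdSimplex.zero_le _ _) (mul_nonneg hγ₃.le (stdSimplex.zero_le _ _))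
  · exact le_rfl

lemma accProb_le_one (hγ₃ : 0 < γ₃) (u : U) (v : V) : D.accProb γ₃ u v ≤ 1 := by
  unfold accProb
  split_ifs with h
  · exact div_le_one_of_le₀ h (mul_nonneg hγ₃.le (stdSimplex.zero_le _ _))
  · exact zero_le_one

/-- A codeword is drawn from `rV` and accepted with probability `qV u v / γ₃` where the likelihood ratio
is at most `γ₃`. The case `rV v = 0` is consistent, since the condition then forces `qV u v = 0`. -/
lemma rV_mul_accProb (hγ₃ : 0 < γ₃) (u : U) (v : V) :
    D.rV v * D.accProb γ₃ u v = 1 / γ₃ * (D.qV u v * ind (D.qV u v ≤ γ₃ * D.rV v)) := by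
  unfold accProb
  by_cases h : D.qV u v ≤ γ₃ * D.rV v
  · rw [if_pos h, ind_of h]
    rcases (stdSimplex.zero_le D.rV v).eq_or_lt with h0 | h0
    · have : D.qV u v = 0 := by
        refine le_antisymm ?_ (stdSimplex.zero_le _ _)
        simpa [← h0] using h
      simp [this]
    · field_simp
  · rw [if_neg h, ind_of_not h]; simp

/-- One draw of the acceptance experiment for `v` given `u`: rejection is `none`, and acceptance comes
with a channel input drawn from `q₂ u v`. -/
def accLaw (hγ₃ : 0 < γ₃) (u : U) (v : V) : stdSimplex ℝ (Option X₂) :=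
  ⟨fun o => o.elim (1 - D.accProb γ₃ u v) fun x => D.accProb γ₃ u v * D.q₂ u v x, by
    rintro (_ | x)
    · exact sub_nonneg.2 (D.accProb_le_one hγ₃ u v)
    · exact mul_nonneg (D.accProb_nonneg hγ₃ u v) (stdSimplex.zero_le _ _), by
    simp [Fintype.sum_option, ← Finset.mul_sum]⟩

lemma ev_accLaw (hγ₃ : 0 < γ₃) (u : U) (v : V) (F : Option X₂ → ℝ) :
    ev (D.accLaw hγ₃ u v) F = (1 - D.accProb γ₃ u v) * F none +
      D.accProb γ₃ u v * ev (D.q₂ u v) fun x => F (some x) := by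
  simp only [ev, Fintype.sum_option, Finset.mul_sum]
  refine congrArg₂ _ rfl (Finset.sum_congr rfl fun x _ => ?_)
  rw [← mul_assoc]; rfl

/-- Each message of user 2 receives `L` independent codewords drawn from `rV`. -/
def bookLaw₂ (M₂ : Type*) [Fintype M₂] [DecidableEq M₂] (L : ℕ) : stdSimplex ℝ (M₂ → Fin L → V) :=
  piPmf fun _ => piPmf fun _ => D.rV

/-- Given the two codebooks `u` and `v`, independent acceptance experiments for each message of
user 2, each coordination message and each of the `L` codewords. -/
def accBookLaw (hγ₃ : 0 < γ₃) {L : ℕ} (u : C → U) (v : M₂ → Fin L → V) :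
    stdSimplex ℝ (M₂ → C → Fin L → Option X₂) :=
  piPmf fun m => piPmf fun c => piPmf fun l => D.accLaw hγ₃ (u c) (v m l)

open Classical in
/-- The channel input of an accepted codeword, if there is one. -/
def pick [Nonempty X₂] {L : ℕ} (e : Fin L → Option X₂) : X₂ :=
  if h : ∃ x l, e l = some x then h.choose else Classical.arbitrary X₂

lemma pick_spec [Nonempty X₂] {L : ℕ} (e : Fin L → Option X₂) :
    (∀ l, e l = none) ∨ ∃ l, e l = some (pick e) := by
  by_cases h : ∃ x l, e l = some x
  · right
    rw [pick, dif_pos h]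
    exact h.choose_spec
  · left
    intro l
    by_contra hl
    obtain ⟨x, hx⟩ := Option.ne_none_iff_exists'.1 hl
    exact h ⟨x, l, hx⟩

/-- Only the experiments for the actual messages matter for the input of user 2. -/
lemma ev_accBookLaw_eval (hγ₃ : 0 < γ₃) {L : ℕ} (u : C → U) (v : M₂ → Fin L → V) (m : M₂) (c : C)
    (F : (Fin L → Option X₂) → ℝ) :
    (ev (D.accBookLaw hγ₃ u v) fun e => F (e m c)) =
      ev (piPmf fun l => D.accLaw hγ₃ (u c) (v m l)) F := by
  rw [accBookLaw, ev_piPmf_eval _ m (fun e : C → Fin L → Option X₂ => F (e c)),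
    ev_piPmf_eval _ c]

lemma ev_rV_accProb (hγ₃ : 0 < γ₃) (u : U) :
    ev D.rV (fun v => D.accProb γ₃ u v) = D.accMass γ₃ u / γ₃ := by
  simp only [ev, D.rV_mul_accProb hγ₃, accMass]
  rw [← Finset.mul_sum]; ring

lemma accMass_nonneg (u : U) : 0 ≤ D.accMass γ₃ u := ev_nonneg _ fun _ => ind_nonneg _

lemma accMass_le_one (u : U) : D.accMass γ₃ u ≤ 1 := ev_le_const _ fun _ => ind_le_one _

/-- Covering: with `L` codewords, the probability that none of them is accepted. -/
lemma ev_forall_none_le (hγ₃ : 0 < γ₃) {L : ℕ} (u : C → U) (m : M₂) (c : C) :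
    (ev (D.bookLaw₂ M₂ L) fun v => ev (D.accBookLaw hγ₃ u v) fun e =>
      ind (∀ l, e m c l = none)) ≤ 1 - D.accMass γ₃ (u c) + Real.exp (-(L / γ₃)) := by
  have h1 : ∀ v : M₂ → Fin L → V, (ev (D.accBookLaw hγ₃ u v) fun e => ind (∀ l, e m c l = none)) =
      ∏ l, (1 - D.accProb γ₃ (u c) (v m l)) := by
    intro v
    rw [D.ev_accBookLaw_eval hγ₃ u v m c fun e => ind (∀ l, e l = none)]
    have : ∀ e : Fin L → Option X₂, ind (∀ l, e l = none) = ∏ l, ind (e l = none) := by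
      intro e
      by_cases h : ∀ l, e l = none
      · rw [ind_of h, Finset.prod_eq_one fun l _ => ind_of (h l)]
      · rw [ind_of_not h]
        obtain ⟨l, hl⟩ := not_forall.1 h
        exact (Finset.prod_eq_zero (Finset.mem_univ l) (ind_of_not hl)).symm
    simp only [this]
    rw [ev_piPmf_prod (fun l => D.accLaw hγ₃ (u c) (v m l)) fun _ o => ind (o = none)]
    refine Finset.prod_congr rfl fun l _ => ?_
    rw [ev_accLaw, ind_of rfl]
    simp [ind]
  simp only [h1]
  rw [bookLaw₂, ev_piPmf_eval _ m fun w : Fin L → V => ∏ l, (1 - D.accProb γ₃ (u c) (w l)),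
    ev_piPmf_prod (fun _ : Fin L => D.rV) fun _ v => 1 - D.accProb γ₃ (u c) v, ev_sub, ev_const,
    D.ev_rV_accProb hγ₃, Finset.prod_const, Finset.card_univ, Fintype.card_fin]
  set α := D.accMass γ₃ (u c)
  have hα0 : 0 ≤ α := D.accMass_nonneg _
  have hα1 : α ≤ 1 := D.accMass_le_one _
  have hβ : 0 ≤ 1 - α / γ₃ := by
    have := ev_le_const D.rV (D.accProb_le_one hγ₃ (u c))
    rw [D.ev_rV_accProb hγ₃] at this
    linarith
  have hexp : (1 - α / γ₃) ^ L ≤ Real.exp (α * -(L / γ₃)) := by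
    refine (pow_le_pow_left₀ hβ (Real.one_sub_le_exp_neg _) L).trans (le_of_eq ?_)
    rw [← Real.exp_nat_mul]; congr 1; ring
  -- convexity of the exponential between `0` and `-L / γ₃`
  have hconv := convexOn_exp.2 (Set.mem_univ (0 : ℝ)) (Set.mem_univ (-(L / γ₃)))
    (sub_nonneg.2 hα1) hα0 (by ring)
  simp only [smul_eq_mul, mul_zero, zero_add, Real.exp_zero, mul_one] at hconv
  have := mul_le_of_le_one_left (Real.exp_pos (-(L / γ₃))).le hα1
  linarith

/-- An accepted codeword and its channel input behave like `V ∼ qV u` and `X₂ ∼ q₂ u V`. -/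
lemma ev_accepted_le (hγ₃ : 0 < γ₃) {L : ℕ} (u : C → U) (m : M₂) (c : C) (l : Fin L)
    {H : V → X₂ → ℝ} (hH : ∀ v x, 0 ≤ H v x) :
    (ev (D.bookLaw₂ M₂ L) fun v => ev (D.accBookLaw hγ₃ u v) fun e =>
      (e m c l).elim 0 (H (v m l))) ≤
      1 / γ₃ * ev (D.qV (u c)) fun v => ev (D.q₂ (u c) v) (H v) := by
  have h1 : ∀ v : M₂ → Fin L → V, (ev (D.accBookLaw hγ₃ u v) fun e =>
      (e m c l).elim 0 (H (v m l))) =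
      D.accProb γ₃ (u c) (v m l) * ev (D.q₂ (u c) (v m l)) (H (v m l)) := by
    intro v
    rw [D.ev_accBookLaw_eval hγ₃ u v m c fun e => (e l).elim 0 (H (v m l)),
      ev_piPmf_eval _ l (fun o : Option X₂ => o.elim 0 (H (v m l))), ev_accLaw]
    simp
  simp only [h1]
  rw [bookLaw₂, ev_piPmf_eval _ m fun w : Fin L → V =>
      D.accProb γ₃ (u c) (w l) * ev (D.q₂ (u c) (w l)) (H (w l)),
    ev_piPmf_eval _ l fun v : V => D.accProb γ₃ (u c) v * ev (D.q₂ (u c) v) (H v)]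
  rw [← ev_const_mul]
  simp only [ev]
  refine Finset.sum_le_sum fun v _ => ?_
  rw [← mul_assoc, D.rV_mul_accProb hγ₃, mul_assoc, mul_left_comm (D.qV (u c) v) (1 / γ₃)]
  refine mul_le_mul_of_nonneg_left ?_ (by positivity)
  have : 0 ≤ ∑ x, D.q₂ (u c) v x * H v x := ev_nonneg (D.q₂ (u c) v) (hH v)
  exact mul_le_mul_of_nonneg_right
    (mul_le_of_le_one_right (stdSimplex.zero_le _ _) (ind_le_one _)) this

/-- The codewords of another message are independent of the channel output. -/
lemma ev_competitor₂_le [Fintype Y₂] [Nonempty X₂] (W₂ : Channel X₂ Y₂) (hγ₃ : 0 < γ₃) {γ₂ : ℝ}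
    (hγ₂ : 0 < γ₂) {L : ℕ} (u : C → U) {m m' : M₂} (hm : m ≠ m') (c : C) (l : Fin L) :
    (ev (D.bookLaw₂ M₂ L) fun v => ev (D.accBookLaw hγ₃ u v) fun e =>
      ev (W₂ (pick (e m c))) fun y => ind (γ₂ < D.d₂ (v m' l) y)) ≤ 1 / γ₂ := by
  have h1 : ∀ v : M₂ → Fin L → V, (ev (D.accBookLaw hγ₃ u v) fun e =>
      ev (W₂ (pick (e m c))) fun y => ind (γ₂ < D.d₂ (v m' l) y)) =
      ev (piPmf fun l => D.accLaw hγ₃ (u c) (v m l)) fun e =>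
        ev (W₂ (pick e)) fun y => ind (γ₂ < D.d₂ (v m' l) y) := fun v =>
    D.ev_accBookLaw_eval hγ₃ u v m c fun e => ev (W₂ (pick e)) fun y => ind (γ₂ < D.d₂ (v m' l) y)
  simp only [h1]
  rw [bookLaw₂, ev_piPmf_eval₂ _ hm fun a b : Fin L → V =>
    ev (piPmf fun l => D.accLaw hγ₃ (u c) (a l)) fun e =>
      ev (W₂ (pick e)) fun y => ind (γ₂ < D.d₂ (b l) y)]
  refine ev_le_const _ fun a => ?_
  rw [ev_comm]
  refine ev_le_const _ fun e => ?_
  rw [ev_comm]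
  refine ev_le_const _ fun y => ?_
  rw [ev_piPmf_eval (fun _ : Fin L => D.rV) l fun v => ind (γ₂ < D.d₂ v y)]
  exact ev_ind_lt_le _ (fun v => D.d₂_nonneg v y) (D.ev_d₂_le y) hγ₂

/-- The test of the second decoder: one of the codewords of the message is likely for `y`. -/
def Test₂ (γ₂ : ℝ) {L : ℕ} (v : M₂ → Fin L → V) (m : M₂) (y : Y₂) : Prop :=
  ∃ l ∈ Finset.univ, γ₂ < D.d₂ (v m l) y

/-- What an accepted codeword `v` with channel input `x₂` costs: the probability that it fails the
test of its decoder, plus a further cost `G` of the channel inputs. -/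
def pairCost [Fintype Y₂] (W₂ : Channel X₂ Y₂) (G : X₁ → X₂ → ℝ) (γ₂ : ℝ) (x₁ : X₁) (v : V)
    (x₂ : X₂) : ℝ :=
  ev (W₂ x₂) (fun y => ind (D.d₂ v y ≤ γ₂)) + G x₁ x₂

lemma pairCost_nonneg [Fintype Y₂] (W₂ : Channel X₂ Y₂) {G : X₁ → X₂ → ℝ} (hG : ∀ x₁ x₂, 0 ≤ G x₁ x₂)
    (γ₂ : ℝ) (x₁ : X₁) (v : V) (x₂ : X₂) : 0 ≤ D.pairCost W₂ G γ₂ x₁ v x₂ :=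
  add_nonneg (ev_nonneg _ fun _ => ind_nonneg _) (hG _ _)

/-- For fixed codebooks, the cost of user 2 is charged to three events: no codeword is accepted, some
accepted codeword is bad, or a codeword of another message passes the test. Summing over all accepted
codewords avoids a discussion of which of them is used. -/
lemma userTwo_pointwise [Fintype Y₂] [Nonempty X₂] (W₂ : Channel X₂ Y₂) {G : X₁ → X₂ → ℝ}
    (hG₀ : ∀ x₁ x₂, 0 ≤ G x₁ x₂) (hG₁ : ∀ x₁ x₂, G x₁ x₂ ≤ 1) (γ₂ : ℝ) (x₁ : X₁) {L : ℕ}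
    (v : M₂ → Fin L → V) (e : Fin L → Option X₂) (m : M₂) :
    ev (W₂ (pick e)) (fun y => ind (decodeUnique (D.Test₂ γ₂ v) y ≠ some m)) + G x₁ (pick e) ≤
      2 * ind (∀ l, e l = none) + ∑ l, (e l).elim 0 (D.pairCost W₂ G γ₂ x₁ (v m l)) +
      ∑ m' ∈ Finset.univ.erase m, ∑ l, ev (W₂ (pick e)) fun y => ind (γ₂ < D.d₂ (v m' l) y) := by
  have hcomp : 0 ≤ ∑ m' ∈ Finset.univ.erase m, ∑ l,
      ev (W₂ (pick e)) fun y => ind (γ₂ < D.d₂ (v m' l) y) :=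
    Finset.sum_nonneg fun _ _ => Finset.sum_nonneg fun _ _ => ev_nonneg _ fun _ => ind_nonneg _
  have helim : ∀ l, 0 ≤ (e l).elim 0 (D.pairCost W₂ G γ₂ x₁ (v m l)) := by
    intro l
    rcases e l with _ | x
    · exact le_rfl
    · exact D.pairCost_nonneg W₂ hG₀ _ _ _ _
  rcases pick_spec e with h | ⟨l, hl⟩
  · rw [ind_of h]
    have h1 : ev (W₂ (pick e)) (fun y => ind (decodeUnique (D.Test₂ γ₂ v) y ≠ some m)) ≤ 1 :=
      ev_le_const _ fun _ => ind_le_one _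
    linarith [hG₁ x₁ (pick e), Finset.sum_nonneg fun l (_ : l ∈ Finset.univ) => helim l]
  · have h1 : D.pairCost W₂ G γ₂ x₁ (v m l) (pick e) ≤
        ∑ l, (e l).elim 0 (D.pairCost W₂ G γ₂ x₁ (v m l)) := by
      refine le_trans (le_of_eq ?_)
        (Finset.single_le_sum (fun l _ => helim l) (Finset.mem_univ l))
      simp only [hl, Option.elim_some]
    have h2 : ev (W₂ (pick e)) (fun y => ind (decodeUnique (D.Test₂ γ₂ v) y ≠ some m)) ≤
        ev (W₂ (pick e)) fun y => ind (D.d₂ (v m l) y ≤ γ₂) +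
          ∑ m' ∈ Finset.univ.erase m, ∑ l, ind (γ₂ < D.d₂ (v m' l) y) := by
      refine ev_mono _ fun y => (ind_decodeUnique_ne_le _ y m).trans (add_le_add ?_ ?_)
      · exact ind_mono fun h => not_lt.1 fun h' => h ⟨l, Finset.mem_univ l, h'⟩
      · exact Finset.sum_le_sum fun m' _ => ind_exists_le _ _
    rw [ev_add, ev_sum] at h2
    simp only [ev_sum] at h2
    have h3 : D.pairCost W₂ G γ₂ x₁ (v m l) (pick e) =
      ev (W₂ (pick e)) (fun y => ind (D.d₂ (v m l) y ≤ γ₂)) + G x₁ (pick e) := rfl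
    linarith [ind_nonneg (∀ l, e l = none)]

/-- The bound on the cost of user 2 given the coordination codeword and the input of user 1; `N` is
the number of messages. -/
def costBound₂ [Fintype Y₂] (W₂ : Channel X₂ Y₂) (G : X₁ → X₂ → ℝ) (γ₂ γ₃ : ℝ) (L N : ℕ) (u : U)
    (x₁ : X₁) : ℝ :=
  2 * (1 - D.accMass γ₃ u + Real.exp (-(L / γ₃))) +
    L / γ₃ * (ev (D.qV u) fun v => ev (D.q₂ u v) (D.pairCost W₂ G γ₂ x₁ v)) + (N - 1) * (L / γ₂)

lemma ev_userTwo_le [Fintype Y₂] [Nonempty X₂] (W₂ : Channel X₂ Y₂) {G : X₁ → X₂ → ℝ}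
    (hG₀ : ∀ x₁ x₂, 0 ≤ G x₁ x₂) (hG₁ : ∀ x₁ x₂, G x₁ x₂ ≤ 1) {γ₂ : ℝ} (hγ₂ : 0 < γ₂)
    (hγ₃ : 0 < γ₃) (x₁ : X₁) (L : ℕ) (u : C → U) (m : M₂) (c : C) :
    (ev (D.bookLaw₂ M₂ L) fun v => ev (D.accBookLaw hγ₃ u v) fun e =>
      ev (W₂ (pick (e m c))) (fun y => ind (decodeUnique (D.Test₂ γ₂ v) y ≠ some m)) +
        G x₁ (pick (e m c))) ≤ D.costBound₂ W₂ G γ₂ γ₃ L (Fintype.card M₂) (u c) x₁ := by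
  refine (ev_mono (D.bookLaw₂ M₂ L) fun v => ev_mono (D.accBookLaw hγ₃ u v) fun e =>
    D.userTwo_pointwise W₂ hG₀ hG₁ γ₂ x₁ v (e m c) m).trans ?_
  simp only [ev_add, ev_const_mul, ev_sum]
  refine add_le_add (add_le_add ?_ ?_) ?_
  · exact mul_le_mul_of_nonneg_left (D.ev_forall_none_le hγ₃ u m c) zero_le_two
  · refine (Finset.sum_le_sum fun l _ => D.ev_accepted_le hγ₃ u m c l
      (H := D.pairCost W₂ G γ₂ x₁) fun v x => D.pairCost_nonneg W₂ hG₀ γ₂ x₁ v x).trans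
      (le_of_eq ?_)
    simp only [Finset.sum_const, Finset.card_univ, Fintype.card_fin, nsmul_eq_mul]
    ring
  · refine (Finset.sum_le_sum fun m' hm' => Finset.sum_le_sum fun l _ =>
      D.ev_competitor₂_le W₂ hγ₃ hγ₂ u (Finset.ne_of_mem_erase hm').symm c l).trans (le_of_eq ?_)
    have hcard : 1 ≤ Fintype.card M₂ := Fintype.card_pos_iff.2 ⟨m⟩
    simp only [Finset.sum_const, Finset.card_univ, Fintype.card_fin, nsmul_eq_mul,
      Finset.card_erase_of_mem (Finset.mem_univ m), Nat.cast_sub hcard, Nat.cast_one]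
    ring

end UserTwo

/-! ### Existence of a good code -/

section Existence

variable {C M₁ M₂ : Type*} [Fintype C] [DecidableEq C] [Nonempty C] [Fintype M₁] [DecidableEq M₁]
  [Fintype M₂] [DecidableEq M₂]

/-- The bound on the average cost of a random code with `N₁` and `N₂` messages and `NC` coordination
messages. -/
def costBound [Fintype Y₁] [Fintype Y₂] (W₁ : Channel X₁ Y₁) (W₂ : Channel X₂ Y₂)
    (G : X₁ → X₂ → ℝ) (γ₁ γ' γ₂ γ₃ : ℝ) (L N₁ N₂ NC : ℕ) : ℝ :=
  (ev D.pU fun u => ev (D.q₁ u) fun x => ev (W₁ x) (fun y => ind (¬D.Test₁ γ₁ γ' u x y)) +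
    D.costBound₂ W₂ G γ₂ γ₃ L N₂ u x) + (N₁ - 1) * (1 / γ₁ + γ' / (NC * γ₁))

lemma ev_userOne_le [Fintype Y₁] (W₁ : Channel X₁ Y₁) {γ₁ γ' : ℝ} (hγ₁ : 0 < γ₁) (hγ' : 0 < γ')
    (m : M₁) :
    (ev (D.coordLaw C) fun u => ev (D.bookLaw₁ M₁ u) fun s =>
      ev (W₁ (s m).2) fun y => ind (decodeUnique
        (fun m y => D.Test₁ γ₁ γ' (u (s m).1) (s m).2 y) y ≠ some m)) ≤
      (ev D.pU fun u => ev (D.q₁ u) fun x => ev (W₁ x) fun y => ind (¬D.Test₁ γ₁ γ' u x y)) +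
        ((Fintype.card M₁ : ℝ) - 1) * (1 / γ₁ + γ' / (Fintype.card C * γ₁)) := by
  refine (ev_mono _ fun u => ev_mono _ fun s => ev_mono _ fun y =>
    ind_decodeUnique_ne_le _ y m).trans ?_
  simp only [ev_add, ev_sum]
  refine add_le_add (le_of_eq ?_) ?_
  · exact D.ev_coordLaw_bookLaw₁ m fun u x => ev (W₁ x) fun y => ind (¬D.Test₁ γ₁ γ' u x y)
  · refine (Finset.sum_le_sum fun m' hm' => D.ev_test₁_competitor_le W₁ hγ₁ hγ'
      (Finset.ne_of_mem_erase hm').symm).trans (le_of_eq ?_)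
    have hcard : 1 ≤ Fintype.card M₁ := Fintype.card_pos_iff.2 ⟨m⟩
    simp only [Finset.sum_const, Finset.card_univ, nsmul_eq_mul,
      Finset.card_erase_of_mem (Finset.mem_univ m), Nat.cast_sub hcard, Nat.cast_one]

/-- The probabilistic method for a single use of the channel. The cost `G` of a pair of inputs stands
for the expected cost of the interference. -/
theorem exists_code [Fintype Y₁] [Fintype Y₂] [Nonempty X₂] (W₁ : Channel X₁ Y₁)
    (W₂ : Channel X₂ Y₂) {G : X₁ → X₂ → ℝ} (hG₀ : ∀ x₁ x₂, 0 ≤ G x₁ x₂)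
    (hG₁ : ∀ x₁ x₂, G x₁ x₂ ≤ 1) {γ₁ γ' γ₂ γ₃ : ℝ} (hγ₁ : 0 < γ₁) (hγ' : 0 < γ') (hγ₂ : 0 < γ₂)
    (hγ₃ : 0 < γ₃) (L : ℕ) :
    ∃ (enc₁ : M₁ → X₁) (enc₂ : M₂ → C → X₂) (coord : M₁ → C) (dec₁ : Y₁ → Option M₁)
      (dec₂ : Y₂ → Option M₂),
      ∑ m₁, ∑ m₂, (ev (W₁ (enc₁ m₁)) (fun y => ind (dec₁ y ≠ some m₁)) +
        (ev (W₂ (enc₂ m₂ (coord m₁))) (fun y => ind (dec₂ y ≠ some m₂)) +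
          G (enc₁ m₁) (enc₂ m₂ (coord m₁)))) ≤
        Fintype.card M₁ * Fintype.card M₂ * D.costBound W₁ W₂ G γ₁ γ' γ₂ γ₃ L (Fintype.card M₁)
          (Fintype.card M₂) (Fintype.card C) := by
  set dec₁ : (C → U) → (M₁ → C × X₁) → Y₁ → Option M₁ := fun u s =>
    decodeUnique fun m y => D.Test₁ γ₁ γ' (u (s m).1) (s m).2 y with hdec₁
  set dec₂ : (M₂ → Fin L → V) → Y₂ → Option M₂ := fun v => decodeUnique (D.Test₂ γ₂ v) with hdec₂
  have key : (ev (D.coordLaw C) fun u => ev (D.bookLaw₁ M₁ u) fun s => ev (D.bookLaw₂ M₂ L) fun v =>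
      ev (D.accBookLaw hγ₃ u v) fun e =>
        ∑ m₁, ∑ m₂, (ev (W₁ (s m₁).2) (fun y => ind (dec₁ u s y ≠ some m₁)) +
        (ev (W₂ (pick (e m₂ (s m₁).1))) (fun y => ind (dec₂ v y ≠ some m₂)) +
          G (s m₁).2 (pick (e m₂ (s m₁).1))))) ≤
      Fintype.card M₁ * Fintype.card M₂ * D.costBound W₁ W₂ G γ₁ γ' γ₂ γ₃ L (Fintype.card M₁)
          (Fintype.card M₂) (Fintype.card C) := by
    simp only [ev_sum]
    calc _ ≤ ∑ m₁ : M₁, ∑ m₂ : M₂, D.costBound W₁ W₂ G γ₁ γ' γ₂ γ₃ L (Fintype.card M₁)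
          (Fintype.card M₂) (Fintype.card C) := by
          refine Finset.sum_le_sum fun m₁ _ => Finset.sum_le_sum fun m₂ _ => ?_
          have h1 : ∀ u s, (ev (D.bookLaw₂ M₂ L) fun v => ev (D.accBookLaw hγ₃ u v) fun e =>
              (ev (W₁ (s m₁).2) (fun y => ind (dec₁ u s y ≠ some m₁)) +
              (ev (W₂ (pick (e m₂ (s m₁).1))) (fun y => ind (dec₂ v y ≠ some m₂)) +
                G (s m₁).2 (pick (e m₂ (s m₁).1))))) ≤
              ev (W₁ (s m₁).2) (fun y => ind (dec₁ u s y ≠ some m₁)) +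
                D.costBound₂ W₂ G γ₂ γ₃ L (Fintype.card M₂) (u (s m₁).1) (s m₁).2 := by
            intro u s
            rw [← ev_const (D.bookLaw₂ M₂ L) (ev (W₁ (s m₁).2) _)]
            have := D.ev_userTwo_le (M₂ := M₂) W₂ hG₀ hG₁ hγ₂ hγ₃ (s m₁).2 L u m₂ (s m₁).1
            simp only [ev_add _ (fun _ => ev (W₁ (s m₁).2) _), ev_const]
            exact add_le_add le_rfl this
          refine (ev_mono _ fun u => ev_mono _ fun s => h1 u s).trans ?_
          simp only [ev_add]
          rw [D.ev_coordLaw_bookLaw₁ m₁ fun u x =>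
            D.costBound₂ W₂ G γ₂ γ₃ L (Fintype.card M₂) u x]
          have := D.ev_userOne_le (C := C) W₁ hγ₁ hγ' m₁
          simp only [costBound, ev_add]
          linarith
      _ = _ := by
          simp only [Finset.sum_const, Finset.card_univ, nsmul_eq_mul]
          ring
  obtain ⟨u, hu⟩ := exists_le_of_ev_le _ key
  obtain ⟨s, hs⟩ := exists_le_of_ev_le _ hu
  obtain ⟨v, hv⟩ := exists_le_of_ev_le _ hs
  obtain ⟨e, he⟩ := exists_le_of_ev_le _ hv
  exact ⟨fun m => (s m).2, fun m c => pick (e m c), fun m => (s m).1, dec₁ u s, dec₂ v, he⟩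

end Existence

end CodingLaw


/-! ### Block codes -/

/-- The memoryless extension of a channel. -/
def blockChannel {X Y : Type*} [Fintype Y] (W : Channel X Y) (n : ℕ) :
    Channel (Fin n → X) (Fin n → Y) :=
  fun x => piPmf fun i => W (x i)

/-- The expected cost `g` of the interference caused by a pair of input blocks. -/
def interferenceCost {X₁ X₂ Z : Type*} [Fintype Z] {n : ℕ} (WZ : Channel (X₁ × X₂) Z)
    (g : (Fin n → Z) → ℝ) (x₁ : Fin n → X₁) (x₂ : Fin n → X₂) : ℝ :=
  ev (piPmf fun i => WZ (x₁ i, x₂ i)) g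

lemma nonempty_of_pmf {A : Type*} [Fintype A] (p : stdSimplex ℝ A) : Nonempty A := by
  by_contra h
  rw [not_nonempty_iff] at h
  have := stdSimplex.sum_eq_one p
  simp at this

namespace CodingLaw

variable {J U V X₁ X₂ Y₁ Y₂ : Type*} [Fintype J] [Fintype U] [Fintype V] [Fintype X₁] [Fintype X₂]

/-- Independent, not necessarily identical coding laws on the coordinates of a block. -/
def pi {ι : Type*} [Fintype ι] [DecidableEq ι] (D : ι → CodingLaw U V X₁ X₂ Y₁ Y₂) :
    CodingLaw (ι → U) (ι → V) (ι → X₁) (ι → X₂) (ι → Y₁) (ι → Y₂) where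
  pU := piPmf fun i => (D i).pU
  q₁ u := piPmf fun i => (D i).q₁ (u i)
  qV u := piPmf fun i => (D i).qV (u i)
  q₂ u v := piPmf fun i => (D i).q₂ (u i) (v i)
  r₁ := piPmf fun i => (D i).r₁
  rV := piPmf fun i => (D i).rV
  d₁ x y := ∏ i, (D i).d₁ (x i) (y i)
  d₂ v y := ∏ i, (D i).d₂ (v i) (y i)
  d₁_nonneg _ _ := Finset.prod_nonneg fun i _ => (D i).d₁_nonneg _ _
  d₂_nonneg _ _ := Finset.prod_nonneg fun i _ => (D i).d₂_nonneg _ _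
  ev_q₁_le x := by
    simp only [piPmf_apply]
    rw [ev_piPmf_prod (fun i => (D i).pU) fun i a => (D i).q₁ a (x i)]
    exact Finset.prod_le_prod (fun i _ => ev_nonneg _ fun _ => stdSimplex.zero_le _ _)
      fun i _ => (D i).ev_q₁_le _
  ev_d₁_le y := by
    rw [ev_piPmf_prod (fun i => (D i).r₁) fun i a => (D i).d₁ a (y i)]
    exact Finset.prod_le_one (fun i _ => ev_nonneg _ fun _ => (D i).d₁_nonneg _ _)
      fun i _ => (D i).ev_d₁_le _
  ev_d₂_le y := by
    rw [ev_piPmf_prod (fun i => (D i).rV) fun i a => (D i).d₂ a (y i)]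
    exact Finset.prod_le_one (fun i _ => ev_nonneg _ fun _ => (D i).d₂_nonneg _ _)
      fun i _ => (D i).ev_d₂_le _

/-- The law of the time-sharing variable, the coordination variable and the first input. -/
def lawX₁ (pJ : stdSimplex ℝ J) (D : J → CodingLaw U V X₁ X₂ Y₁ Y₂) : stdSimplex ℝ ((J × U) × X₁) :=
  pairPmf (pairPmf pJ fun j => (D j).pU) fun a => (D a.1).q₁ a.2

/-- The law of the time-sharing variable, the coordination variable and the auxiliary variable. -/
def lawV (pJ : stdSimplex ℝ J) (D : J → CodingLaw U V X₁ X₂ Y₁ Y₂) : stdSimplex ℝ ((J × U) × V) :=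
  pairPmf (pairPmf pJ fun j => (D j).pU) fun a => (D a.1).qV a.2

/-- `lawX₁` with the output of user 1. -/
def lawY₁ [Fintype Y₁] (pJ : stdSimplex ℝ J) (D : J → CodingLaw U V X₁ X₂ Y₁ Y₂)
    (W₁ : Channel X₁ Y₁) : stdSimplex ℝ (((J × U) × X₁) × Y₁) :=
  pairPmf (lawX₁ pJ D) fun a => W₁ a.2

/-- `lawV` with the input and the output of user 2. -/
def lawY₂ [Fintype Y₂] (pJ : stdSimplex ℝ J) (D : J → CodingLaw U V X₁ X₂ Y₁ Y₂)
    (W₂ : Channel X₂ Y₂) : stdSimplex ℝ ((((J × U) × V) × X₂) × Y₂) :=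
  pairPmf (pairPmf (lawV pJ D) fun a => (D a.1.1).q₂ a.1.2 a.2) fun a => W₂ a.2

/-- The law of all variables on which the interference depends. -/
def lawZ {Z : Type*} [Fintype Z] (pJ : stdSimplex ℝ J) (D : J → CodingLaw U V X₁ X₂ Y₁ Y₂)
    (WZ : Channel (X₁ × X₂) Z) : stdSimplex ℝ (((((J × U) × X₁) × V) × X₂) × Z) :=
  pairPmf (pairPmf (pairPmf (lawX₁ pJ D) fun a => (D a.1.1).qV a.1.2)
    fun a => (D a.1.1.1).q₂ a.1.1.2 a.2) fun a => WZ (a.1.1.2, a.2)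

variable (pJ : stdSimplex ℝ J) (D : J → CodingLaw U V X₁ X₂ Y₁ Y₂) {n : ℕ}

lemma ev_block_lawX₁ (F : (Fin n → J) → (Fin n → U) → (Fin n → X₁) → ℝ) :
    (ev (piPmf fun _ : Fin n => pJ) fun j => ev (pi fun i => D (j i)).pU fun u =>
      ev ((pi fun i => D (j i)).q₁ u) fun x => F j u x) =
      ev (piPmf fun _ : Fin n => lawX₁ pJ D) fun w =>
        F (fun i => (w i).1.1) (fun i => (w i).1.2) fun i => (w i).2 :=
  (ev_piPmf_ev_piPmf (fun _ : Fin n => pJ) (fun _ j => (D j).pU) fun j u =>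
    ev ((pi fun i => D (j i)).q₁ u) fun x => F j u x).trans
  (ev_piPmf_ev_piPmf (fun _ : Fin n => pairPmf pJ fun j => (D j).pU) (fun _ a => (D a.1).q₁ a.2)
    fun a x => F (fun i => (a i).1) (fun i => (a i).2) x)

lemma ev_block_lawV (F : (Fin n → J) → (Fin n → U) → (Fin n → V) → ℝ) :
    (ev (piPmf fun _ : Fin n => pJ) fun j => ev (pi fun i => D (j i)).pU fun u =>
      ev ((pi fun i => D (j i)).qV u) fun v => F j u v) =
      ev (piPmf fun _ : Fin n => lawV pJ D) fun w =>
        F (fun i => (w i).1.1) (fun i => (w i).1.2) fun i => (w i).2 :=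
  (ev_piPmf_ev_piPmf (fun _ : Fin n => pJ) (fun _ j => (D j).pU) fun j u =>
    ev ((pi fun i => D (j i)).qV u) fun v => F j u v).trans
  (ev_piPmf_ev_piPmf (fun _ : Fin n => pairPmf pJ fun j => (D j).pU) (fun _ a => (D a.1).qV a.2)
    fun a v => F (fun i => (a i).1) (fun i => (a i).2) v)

lemma ev_block_lawY₁ [Fintype Y₁] (W₁ : Channel X₁ Y₁)
    (F : (Fin n → J) → (Fin n → U) → (Fin n → X₁) → (Fin n → Y₁) → ℝ) :
    (ev (piPmf fun _ : Fin n => pJ) fun j => ev (pi fun i => D (j i)).pU fun u =>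
      ev ((pi fun i => D (j i)).q₁ u) fun x => ev (blockChannel W₁ n x) fun y => F j u x y) =
      ev (piPmf fun _ : Fin n => lawY₁ pJ D W₁) fun w => F (fun i => (w i).1.1.1)
        (fun i => (w i).1.1.2) (fun i => (w i).1.2) fun i => (w i).2 :=
  (ev_block_lawX₁ pJ D fun j u x => ev (blockChannel W₁ n x) fun y => F j u x y).trans
  (ev_piPmf_ev_piPmf (fun _ : Fin n => lawX₁ pJ D) (fun _ a => W₁ a.2)
    fun a y => F (fun i => (a i).1.1) (fun i => (a i).1.2) (fun i => (a i).2) y)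

lemma ev_block_lawY₂ [Fintype Y₂] (W₂ : Channel X₂ Y₂)
    (F : (Fin n → J) → (Fin n → V) → (Fin n → Y₂) → ℝ) :
    (ev (piPmf fun _ : Fin n => pJ) fun j => ev (pi fun i => D (j i)).pU fun u =>
      ev ((pi fun i => D (j i)).qV u) fun v => ev ((pi fun i => D (j i)).q₂ u v) fun x =>
        ev (blockChannel W₂ n x) fun y => F j v y) =
      ev (piPmf fun _ : Fin n => lawY₂ pJ D W₂) fun w =>
        F (fun i => (w i).1.1.1.1) (fun i => (w i).1.1.2) fun i => (w i).2 :=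
  (ev_block_lawV pJ D fun j u v => ev ((pi fun i => D (j i)).q₂ u v) fun x =>
    ev (blockChannel W₂ n x) fun y => F j v y).trans <|
  (ev_piPmf_ev_piPmf (fun _ : Fin n => lawV pJ D) (fun _ a => (D a.1.1).q₂ a.1.2 a.2)
    fun a x => ev (blockChannel W₂ n x) fun y => F (fun i => (a i).1.1) (fun i => (a i).2) y).trans
  (ev_piPmf_ev_piPmf (fun _ : Fin n => pairPmf (lawV pJ D) fun a => (D a.1.1).q₂ a.1.2 a.2)
    (fun _ a => W₂ a.2) fun a y => F (fun i => (a i).1.1.1) (fun i => (a i).1.2) y)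

lemma ev_block_lawZ {Z : Type*} [Fintype Z] (WZ : Channel (X₁ × X₂) Z) (g : (Fin n → Z) → ℝ) :
    (ev (piPmf fun _ : Fin n => pJ) fun j => ev (pi fun i => D (j i)).pU fun u =>
      ev ((pi fun i => D (j i)).q₁ u) fun x₁ => ev ((pi fun i => D (j i)).qV u) fun v =>
        ev ((pi fun i => D (j i)).q₂ u v) fun x₂ => interferenceCost WZ g x₁ x₂) =
      ev (piPmf fun _ : Fin n => lawZ pJ D WZ) fun w => g fun i => (w i).2 :=
  (ev_block_lawX₁ pJ D fun j u x₁ => ev ((pi fun i => D (j i)).qV u) fun v =>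
        ev ((pi fun i => D (j i)).q₂ u v) fun x₂ => interferenceCost WZ g x₁ x₂).trans <|
  (ev_piPmf_ev_piPmf (fun _ : Fin n => lawX₁ pJ D) (fun _ a => (D a.1.1).qV a.1.2)
    fun a v => ev ((pi fun i => D (a i).1.1).q₂ (fun i => (a i).1.2) v) fun x₂ =>
      interferenceCost WZ g (fun i => (a i).2) x₂).trans <|
  (ev_piPmf_ev_piPmf (fun _ : Fin n => pairPmf (lawX₁ pJ D) fun a => (D a.1.1).qV a.1.2)
    (fun _ a => (D a.1.1.1).q₂ a.1.1.2 a.2) fun a x₂ =>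
      interferenceCost WZ g (fun i => (a i).1.2) x₂).trans
  (ev_piPmf_ev_piPmf (fun _ : Fin n => pairPmf (pairPmf (lawX₁ pJ D) fun a => (D a.1.1).qV a.1.2)
    fun a => (D a.1.1.1).q₂ a.1.1.2 a.2) (fun _ a => WZ (a.1.1.2, a.2)) fun _ z => g z)

/-! ### The average cost of random block codes -/

/-- The mean of the logarithm of the density `d₁`: the information that the output of user 1 carries
about its input. -/
def rate₁ [Fintype Y₁] (W₁ : Channel X₁ Y₁) : ℝ :=
  ev (lawY₁ pJ D W₁) fun a => Real.logb 2 ((D a.1.1.1).d₁ a.1.2 a.2)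

/-- The mean of the logarithm of the density `d₂`. -/
def rate₂ [Fintype Y₂] (W₂ : Channel X₂ Y₂) : ℝ :=
  ev (lawY₂ pJ D W₂) fun a => Real.logb 2 ((D a.1.1.1.1).d₂ a.1.1.2 a.2)

/-- The coordination rate: the information between the coordination variable and the first input. -/
def coordRate : ℝ :=
  ev (lawX₁ pJ D) fun a => Real.logb 2 ((D a.1.1).q₁ a.1.2 a.2 / (D a.1.1).r₁ a.2)

/-- The covering rate: the information between the coordination variable and the auxiliary one. -/
def coverRate : ℝ :=
  ev (lawV pJ D) fun a => Real.logb 2 ((D a.1.1).qV a.1.2 a.2 / (D a.1.1).rV a.2)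

lemma r₁_pos (D : CodingLaw U V X₁ X₂ Y₁ Y₂) {u : U} {x : X₁} (hu : 0 < D.pU u) (hx : 0 < D.q₁ u x) :
    0 < D.r₁ x :=
  (mul_pos hu hx).trans_le <| (Finset.single_le_sum (f := fun u => D.pU u * D.q₁ u x)
    (fun _ _ => mul_nonneg (stdSimplex.zero_le _ _) (stdSimplex.zero_le _ _))
    (Finset.mem_univ u)).trans (D.ev_q₁_le x)

/-- A coding law is supported if the reference pmfs and the densities are positive wherever the joint
law of the variables is. -/
structure Supported [Fintype Y₁] [Fintype Y₂] (D : CodingLaw U V X₁ X₂ Y₁ Y₂) (W₁ : Channel X₁ Y₁)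
    (W₂ : Channel X₂ Y₂) : Prop where
  rV_pos : ∀ u v, 0 < D.pU u → 0 < D.qV u v → 0 < D.rV v
  d₁_pos : ∀ u x y, 0 < D.pU u → 0 < D.q₁ u x → 0 < W₁ x y → 0 < D.d₁ x y
  d₂_pos : ∀ u v x y, 0 < D.pU u → 0 < D.qV u v → 0 < D.q₂ u v x → 0 < W₂ x y → 0 < D.d₂ v y

lemma coordRate_nonneg : 0 ≤ coordRate pJ D := by
  refine ev_logb_nonneg _ _ (fun a ha => ?_) ?_
  · obtain ⟨h1, h2⟩ := pos_of_pairPmf_pos ha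
    exact div_pos h2 ((D a.1.1).r₁_pos (pos_of_pairPmf_pos h1).2 h2)
  · rw [lawX₁, ev_pairPmf]
    refine ev_le_const _ fun a => ?_
    rw [← stdSimplex.sum_eq_one (D a.1).r₁]
    refine Finset.sum_le_sum fun x _ => ?_
    rcases (stdSimplex.zero_le ((D a.1).q₁ a.2) x).eq_or_lt with h0 | h0
    · simp [← h0, stdSimplex.zero_le]
    · dsimp only
      rw [inv_div, mul_div_cancel₀ _ h0.ne']

lemma coverRate_nonneg (hrV : ∀ j u v, 0 < (D j).pU u → 0 < (D j).qV u v → 0 < (D j).rV v) :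
    0 ≤ coverRate pJ D := by
  refine ev_logb_nonneg _ _ (fun a ha => ?_) ?_
  · obtain ⟨h1, h2⟩ := pos_of_pairPmf_pos ha
    exact div_pos h2 (hrV _ _ _ (pos_of_pairPmf_pos h1).2 h2)
  · rw [lawV, ev_pairPmf]
    refine ev_le_const _ fun a => ?_
    rw [← stdSimplex.sum_eq_one (D a.1).rV]
    refine Finset.sum_le_sum fun v _ => ?_
    rcases (stdSimplex.zero_le ((D a.1).qV a.2) v).eq_or_lt with h0 | h0
    · simp [← h0, stdSimplex.zero_le]
    · dsimp only
      rw [inv_div, mul_div_cancel₀ _ h0.ne']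

end CodingLaw


namespace CodingLaw

variable {J U V X₁ X₂ Y₁ Y₂ : Type*} [Fintype J] [Fintype U] [Fintype V] [Fintype X₁] [Fintype X₂]
  (pJ : stdSimplex ℝ J) (D : J → CodingLaw U V X₁ X₂ Y₁ Y₂)

lemma one_sub_accMass (D : CodingLaw U V X₁ X₂ Y₁ Y₂) (γ₃ : ℝ) (u : U) :
    1 - D.accMass γ₃ u = ev (D.qV u) fun v => ind (¬D.qV u v ≤ γ₃ * D.rV v) := by
  rw [accMass, ← ev_const (D.qV u) 1, ← ev_sub]
  refine congrArg _ (funext fun v => ?_)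
  by_cases h : D.qV u v ≤ γ₃ * D.rV v
  · rw [ind_of h, ind_of_not (not_not.2 h), sub_self]
  · rw [ind_of_not h, ind_of h, sub_zero]

lemma ev_pairCost [Fintype Y₂] (D : CodingLaw U V X₁ X₂ Y₁ Y₂) (p : stdSimplex ℝ X₂)
    (W₂ : Channel X₂ Y₂) (G : X₁ → X₂ → ℝ) (γ₂ : ℝ) (x₁ : X₁) (v : V) :
    ev p (D.pairCost W₂ G γ₂ x₁ v) =
      ev p (fun x₂ => ev (W₂ x₂) fun y => ind (D.d₂ v y ≤ γ₂)) + ev p fun x₂ => G x₁ x₂ :=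
  ev_add _ _ _

/-- The cost bound of a block code, averaged over independent time-sharing variables, in terms of
independent copies of the single-letter variables. -/
lemma ev_costBound_le [Fintype Y₁] [Fintype Y₂] (W₁ : Channel X₁ Y₁) (W₂ : Channel X₂ Y₂)
    {Z : Type*} [Fintype Z] (WZ : Channel (X₁ × X₂) Z) {n : ℕ} (g : (Fin n → Z) → ℝ)
    (γ₁ γ' γ₂ γ₃ : ℝ) (L N₁ N₂ NC : ℕ) :
    (ev (piPmf fun _ : Fin n => pJ) fun j => (pi fun i => D (j i)).costBound (blockChannel W₁ n)
      (blockChannel W₂ n) (interferenceCost WZ g) γ₁ γ' γ₂ γ₃ L N₁ N₂ NC) ≤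
    (ev (piPmf fun _ : Fin n => lawY₁ pJ D W₁) fun w =>
      ind (∏ i, (D (w i).1.1.1).d₁ (w i).1.2 (w i).2 ≤ γ₁)) +
    (ev (piPmf fun _ : Fin n => lawX₁ pJ D) fun w =>
      ind (¬∏ i, (D (w i).1.1).q₁ (w i).1.2 (w i).2 ≤ γ' * ∏ i, (D (w i).1.1).r₁ (w i).2)) +
    (2 * ((ev (piPmf fun _ : Fin n => lawV pJ D) fun w =>
      ind (¬∏ i, (D (w i).1.1).qV (w i).1.2 (w i).2 ≤ γ₃ * ∏ i, (D (w i).1.1).rV (w i).2)) +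
        Real.exp (-(L / γ₃))) +
      L / γ₃ * ((ev (piPmf fun _ : Fin n => lawY₂ pJ D W₂) fun w =>
        ind (∏ i, (D (w i).1.1.1.1).d₂ (w i).1.1.2 (w i).2 ≤ γ₂)) +
        ev (piPmf fun _ : Fin n => lawZ pJ D WZ) fun w => g fun i => (w i).2) +
      (N₂ - 1) * (L / γ₂)) + (N₁ - 1) * (1 / γ₁ + γ' / (NC * γ₁)) := by
  have hY₁ := ev_block_lawY₁ pJ D W₁ (n := n) fun j _ x y => ind (∏ i, (D (j i)).d₁ (x i) (y i) ≤ γ₁)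
  have hX₁ := ev_block_lawX₁ pJ D (n := n) fun j u x =>
    ind (¬∏ i, (D (j i)).q₁ (u i) (x i) ≤ γ' * ∏ i, (D (j i)).r₁ (x i))
  have hV := ev_block_lawV pJ D (n := n) fun j u v =>
    ind (¬∏ i, (D (j i)).qV (u i) (v i) ≤ γ₃ * ∏ i, (D (j i)).rV (v i))
  have hY₂ := ev_block_lawY₂ pJ D W₂ (n := n) fun j v y => ind (∏ i, (D (j i)).d₂ (v i) (y i) ≤ γ₂)
  have hZ := ev_block_lawZ pJ D WZ g
  rw [← hY₁, ← hX₁, ← hV, ← hY₂, ← hZ]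
  simp only [costBound, costBound₂, ev_pairCost, one_sub_accMass, ev_add, ev_const_mul, ev_const]
  have hTest : (ev (piPmf fun _ : Fin n => pJ) fun j => ev (pi fun i => D (j i)).pU fun u =>
      ev ((pi fun i => D (j i)).q₁ u) fun x => ev (blockChannel W₁ n x) fun y =>
        ind (¬(pi fun i => D (j i)).Test₁ γ₁ γ' u x y)) ≤
      (ev (piPmf fun _ : Fin n => pJ) fun j => ev (pi fun i => D (j i)).pU fun u =>
        ev ((pi fun i => D (j i)).q₁ u) fun x => ev (blockChannel W₁ n x) fun y =>
          ind (∏ i, (D (j i)).d₁ (x i) (y i) ≤ γ₁)) +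
      (ev (piPmf fun _ : Fin n => pJ) fun j => ev (pi fun i => D (j i)).pU fun u =>
        ev ((pi fun i => D (j i)).q₁ u) fun x =>
          ind (¬∏ i, (D (j i)).q₁ (u i) (x i) ≤ γ' * ∏ i, (D (j i)).r₁ (x i))) := by
    simp only [← ev_add]
    refine ev_mono _ fun j => ev_mono _ fun u => ev_mono _ fun x => ?_
    rw [← ev_const (blockChannel W₁ n x) (ind (¬∏ i, _ ≤ _)), ← ev_add]
    refine ev_mono _ fun y => le_trans (ind_mono fun h => ?_) (ind_or_le _ _)
    by_contra! hc
    exact h ⟨hc.1, hc.2⟩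
  refine add_le_add (add_le_add hTest (le_of_eq ?_)) le_rfl
  rfl

end CodingLaw


/-! ### Vanishing of the cost -/

lemma ev_ind_not_prod_le_le {Ω : Type*} [Fintype Ω] (p : stdSimplex ℝ Ω) (a b : Ω → ℝ)
    (ha : ∀ ω, 0 < p ω → 0 < a ω) (hb : ∀ ω, 0 < p ω → 0 < b ω) {t : ℝ}
    (ht : ev p (fun ω => Real.logb 2 (a ω / b ω)) < t) :
    ∃ c : ℝ, ∀ n : ℕ, 0 < n → ev (piPmf fun _ : Fin n => p)
      (fun w => ind (¬∏ i, a (w i) ≤ (2 : ℝ) ^ (n * t) * ∏ i, b (w i))) ≤ c / n := by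
  obtain ⟨c, hc⟩ := ev_ind_lt_prod_le p (fun ω => a ω / b ω)
    (fun ω hω => div_pos (ha ω hω) (hb ω hω)) ht
  refine ⟨c, fun n hn => le_trans (ev_mono_of_pos _ fun w hw => ind_mono fun h => ?_) (hc n hn)⟩
  rw [Finset.prod_div_distrib,
    lt_div_iff₀ (Finset.prod_pos fun i _ => hb _ (pos_of_piPmf_pos hw i))]
  exact not_le.1 h

/-- The mean squared deviation of the type of `z` from `Q`: a cost bounded by `1` that controls the
total variation. -/
def typeDev {Z : Type*} [Fintype Z] (Q : Z → ℝ) {n : ℕ} (z : Fin n → Z) : ℝ :=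
  1 / (Fintype.card Z : ℝ) * ∑ a, (seqType z a - Q a) ^ 2

lemma typeDev_nonneg {Z : Type*} [Fintype Z] (Q : Z → ℝ) {n : ℕ} (z : Fin n → Z) :
    0 ≤ typeDev Q z :=
  mul_nonneg (by positivity) (Finset.sum_nonneg fun _ _ => sq_nonneg _)

lemma seqType_eq {Z : Type*} {n : ℕ} (z : Fin n → Z) (a : Z) :
    seqType z a = 1 / n * ∑ i, ind (z i = a) := rfl

lemma seqType_mem_Icc {Z : Type*} {n : ℕ} (z : Fin n → Z) (a : Z) :
    seqType z a ∈ Set.Icc (0 : ℝ) 1 := by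
  rw [seqType_eq]
  refine ⟨mul_nonneg (by positivity) (Finset.sum_nonneg fun _ _ => ind_nonneg _), ?_⟩
  have : ∑ i, ind (z i = a) ≤ n := by
    simpa using Finset.sum_le_sum fun i (_ : i ∈ Finset.univ) => ind_le_one (z i = a)
  rw [one_div, inv_mul_eq_div]
  exact div_le_one_of_le₀ this (by positivity)

lemma typeDev_le_one {Z : Type*} [Fintype Z] {Q : Z → ℝ} (hQ : ∀ a, Q a ∈ Set.Icc (0 : ℝ) 1) {n : ℕ}
    (z : Fin n → Z) : typeDev Q z ≤ 1 := by
  have : ∑ a, (seqType z a - Q a) ^ 2 ≤ Fintype.card Z := by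
    have := Finset.sum_le_sum fun a (_ : a ∈ Finset.univ) =>
      show (seqType z a - Q a) ^ 2 ≤ 1 by
        obtain ⟨h1, h2⟩ := seqType_mem_Icc z a
        obtain ⟨h3, h4⟩ := hQ a
        exact (sq_le_one_iff_abs_le_one _).2 (abs_le.2 ⟨by linarith, by linarith⟩)
    simpa using this
  rw [typeDev, one_div, inv_mul_eq_div]
  exact div_le_one_of_le₀ this (by positivity)

/-- A total variation of at least `ε` is bounded by the cost `typeDev`, by Cauchy-Schwarz. -/
lemma ind_le_tv_le {Z : Type*} [Fintype Z] (Q : Z → ℝ) {n : ℕ} (z : Fin n → Z) {ε : ℝ} (hε : 0 < ε) :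
    ind (ε ≤ tv (seqType z) Q) ≤ (Fintype.card Z : ℝ) ^ 2 / (2 * ε) ^ 2 * typeDev Q z := by
  by_cases h : ε ≤ tv (seqType z) Q
  · rw [ind_of h, div_mul_eq_mul_div, one_le_div (by positivity)]
    have h1 : 2 * ε ≤ ∑ a, |seqType z a - Q a| := by
      unfold tv at h; linarith
    have h2 := sq_sum_le_card_mul_sum_sq (s := Finset.univ) (f := fun a => |seqType z a - Q a|)
    simp only [sq_abs, Finset.card_univ] at h2
    have h3 : (Fintype.card Z : ℝ) ^ 2 * typeDev Q z =
        Fintype.card Z * ∑ a, (seqType z a - Q a) ^ 2 := by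
      rcases isEmpty_or_nonempty Z with hZ | hZ
      · simp
      · rw [typeDev]; field_simp
    rw [h3]
    exact (pow_le_pow_left₀ (by positivity) h1 2).trans h2
  · rw [ind_of_not h]; exact mul_nonneg (by positivity) (typeDev_nonneg _ _)

/-- The type of a memoryless sequence concentrates on the law of its letters. -/
lemma ev_typeDev_le {Ω Z : Type*} [Fintype Ω] [Fintype Z] (p : stdSimplex ℝ Ω) (f : Ω → Z)
    {Q : Z → ℝ} (hQ : ∀ a, Q a ∈ Set.Icc (0 : ℝ) 1) (hf : ∀ a, ev p (fun ω => ind (f ω = a)) = Q a)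
    {n : ℕ} (hn : 0 < n) :
    ev (piPmf fun _ : Fin n => p) (fun w => typeDev Q fun i => f (w i)) ≤ 1 / n := by
  have hn' : (0 : ℝ) < n := by exact_mod_cast hn
  have h1 : ∀ a, ev (piPmf fun _ : Fin n => p) (fun w => (seqType (fun i => f (w i)) a - Q a) ^ 2) ≤
      1 / n := by
    intro a
    have heq : ∀ w : Fin n → Ω, (seqType (fun i => f (w i)) a - Q a) ^ 2 =
        1 / n ^ 2 * (∑ i, (ind (f (w i) = a) - Q a)) ^ 2 := by
      intro w
      rw [seqType_eq, Finset.sum_sub_distrib]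
      simp only [Finset.sum_const, Finset.card_univ, Fintype.card_fin, nsmul_eq_mul]
      field_simp
    simp only [heq]
    rw [ev_const_mul, ev_piPmf_sq_sum p (fun ω => ind (f ω = a) - Q a)
      (by rw [ev_sub, ev_const, hf]; exact sub_self _), Fintype.card_fin]
    have hvar : ev p (fun ω => (ind (f ω = a) - Q a) ^ 2) ≤ 1 := ev_le_const _ fun ω => by
      obtain ⟨h3, h4⟩ := hQ a
      exact (sq_le_one_iff_abs_le_one _).2 (abs_le.2
        ⟨by linarith [ind_nonneg (f ω = a)], by linarith [ind_le_one (f ω = a)]⟩)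
    calc 1 / (n : ℝ) ^ 2 * ((n : ℝ) * ev p fun ω => (ind (f ω = a) - Q a) ^ 2)
        ≤ 1 / (n : ℝ) ^ 2 * ((n : ℝ) * 1) := by gcongr
      _ = 1 / (n : ℝ) := by field_simp
  simp only [typeDev, ev_const_mul, ev_sum]
  refine (mul_le_mul_of_nonneg_left (Finset.sum_le_sum fun a _ => h1 a) (by positivity)).trans ?_
  rw [Finset.sum_const, Finset.card_univ, nsmul_eq_mul, ← mul_assoc, one_div_mul_eq_div]
  exact mul_le_of_le_one_left (by positivity) (div_self_le_one _)

/-- The limit of the bounds on the average cost of random codes. -/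
lemma tendsto_costBound (a b : ℝ) {r r₁ r₂ : ℝ} (hr : r ∈ Set.Ico (0 : ℝ) 1)
    (hr₁ : r₁ ∈ Set.Ico (0 : ℝ) 1) (hr₂ : r₂ ∈ Set.Ico (0 : ℝ) 1) :
    Tendsto (fun n : ℕ => a / n + 2 * Real.exp (-√n) + (√n + 1) * (b / n) + (√n + 1) * r ^ n +
      (r₁ ^ n + 2 * r₂ ^ n)) atTop (𝓝 0) := by
  have hcast : Tendsto (fun n : ℕ => (n : ℝ)) atTop atTop := tendsto_natCast_atTop_atTop
  have hsqrt : Tendsto (fun n : ℕ => √(n : ℝ)) atTop atTop := Real.tendsto_sqrt_atTop.comp hcast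
  have h1 : Tendsto (fun n : ℕ => a / (n : ℝ)) atTop (𝓝 0) := tendsto_const_div_atTop_nhds_zero_nat a
  have h2 : Tendsto (fun n : ℕ => 2 * Real.exp (-√(n : ℝ))) atTop (𝓝 0) := by
    simpa using (Real.tendsto_exp_neg_atTop_nhds_zero.comp hsqrt).const_mul 2
  have h3 : Tendsto (fun n : ℕ => (√(n : ℝ) + 1) * (b / n)) atTop (𝓝 0) := by
    have h := (hsqrt.inv_tendsto_atTop.mul_const b).add (tendsto_const_div_atTop_nhds_zero_nat b)
    rw [zero_mul, add_zero] at h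
    refine h.congr fun n => ?_
    have : (√(n : ℝ))⁻¹ = √n / n := by
      rw [Real.sqrt_div_self]
    simp only [Pi.inv_apply, this]
    ring
  have h4 : Tendsto (fun n : ℕ => (√(n : ℝ) + 1) * r ^ n) atTop (𝓝 0) := by
    have h := (tendsto_pow_const_mul_const_pow_of_abs_lt_one 1
      (by rw [abs_of_nonneg hr.1]; exact hr.2)).add
      ((tendsto_pow_atTop_nhds_zero_of_lt_one hr.1 hr.2).const_mul 2)
    rw [mul_zero, add_zero] at h
    refine squeeze_zero (fun n => mul_nonneg (by positivity) (pow_nonneg hr.1 n)) (fun n => ?_) h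
    have hs : √(n : ℝ) ≤ n + 1 := by
      rw [Real.sqrt_le_left (by positivity)]
      nlinarith [(Nat.cast_nonneg n : (0 : ℝ) ≤ n)]
    have := mul_le_mul_of_nonneg_right (add_le_add_left hs 1) (pow_nonneg hr.1 n)
    simp only [pow_one]
    linarith
  have h5 := (tendsto_pow_atTop_nhds_zero_of_lt_one hr₁.1 hr₁.2).add
    ((tendsto_pow_atTop_nhds_zero_of_lt_one hr₂.1 hr₂.2).const_mul 2)
  have := (((h1.add h2).add h3).add h4).add h5
  simpa using this

namespace CodingLaw

variable {J U V X₁ X₂ Y₁ Y₂ Z : Type*} [Fintype J] [Fintype U] [Fintype V] [Fintype X₁] [Fintype X₂]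
  [Fintype Z] (pJ : stdSimplex ℝ J) (D : J → CodingLaw U V X₁ X₂ Y₁ Y₂) (WZ : Channel (X₁ × X₂) Z)

/-- The law of the interference. -/
def outZ (z : Z) : ℝ := ev (lawZ pJ D WZ) fun a => ind (a.2 = z)

lemma outZ_mem_Icc (z : Z) : outZ pJ D WZ z ∈ Set.Icc (0 : ℝ) 1 :=
  ⟨ev_nonneg _ fun _ => ind_nonneg _, ev_le_const _ fun _ => ind_le_one _⟩

lemma outZ_mem_stdSimplex : outZ pJ D WZ ∈ stdSimplex ℝ Z := by
  refine ⟨fun z => (outZ_mem_Icc pJ D WZ z).1, ?_⟩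
  simp only [outZ]
  rw [← ev_sum]
  have h : ∀ b : Z, ∑ z, ind (b = z) = 1 := fun b => by
    rw [Finset.sum_eq_single b (fun z _ hz => ind_of_not hz.symm) (by simp), ind_of rfl]
  simp only [h, ev_const]

/-- For every block length there are thresholds and a number of codewords per message for which the
average cost of random codes vanishes, if the rates satisfy the single-letter conditions. -/
lemma exists_thresholds [Fintype Y₁] [Fintype Y₂] (W₁ : Channel X₁ Y₁) (W₂ : Channel X₂ Y₂)
    (hD : ∀ j, (D j).Supported W₁ W₂) {R₁ R₂ Rc : ℝ} (h₁ : R₁ < rate₁ pJ D W₁)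
    (h₂ : R₂ < rate₂ pJ D W₂ - coverRate pJ D) (hc : coordRate pJ D < Rc) :
    ∃ γ₁ γ' γ₂ γ₃ : ℕ → ℝ, ∃ L : ℕ → ℕ, ∃ B : ℕ → ℝ,
      (∀ n, 0 < γ₁ n ∧ 0 < γ' n ∧ 0 < γ₂ n ∧ 0 < γ₃ n) ∧ Tendsto B atTop (𝓝 0) ∧
      ∀ n, 0 < n → (ev (piPmf fun _ : Fin n => pJ) fun j =>
        (pi fun i => D (j i)).costBound (blockChannel W₁ n) (blockChannel W₂ n)
          (interferenceCost WZ (typeDev (outZ pJ D WZ))) (γ₁ n) (γ' n) (γ₂ n) (γ₃ n) (L n)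
          (Fintype.card (Msg n R₁)) (Fintype.card (Msg n R₂)) (Fintype.card (CoordMsg n Rc))) ≤
        B n := by
  have hRc : 0 < Rc := (coordRate_nonneg pJ D).trans_lt hc
  have hcov := coverRate_nonneg pJ D fun j => (hD j).rV_pos
  obtain ⟨t₁, ht₁, ht₁'⟩ := exists_between h₁
  obtain ⟨t', ht', ht''⟩ := exists_between hc
  obtain ⟨t₃, ht₃, ht₃'⟩ := exists_between (show coverRate pJ D < rate₂ pJ D W₂ - R₂ by linarith)
  obtain ⟨t₂, ht₂, ht₂'⟩ := exists_between (show R₂ + t₃ < rate₂ pJ D W₂ by linarith)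
  obtain ⟨c₁, hc₁⟩ := ev_ind_prod_le_le (lawY₁ pJ D W₁) _ (fun a ha => by
    obtain ⟨h1, h2⟩ := pos_of_pairPmf_pos ha
    obtain ⟨h3, h4⟩ := pos_of_pairPmf_pos h1
    exact (hD _).d₁_pos _ _ _ (pos_of_pairPmf_pos h3).2 h4 h2) ht₁'
  obtain ⟨c', hc'⟩ := ev_ind_not_prod_le_le (lawX₁ pJ D) _ _
    (fun a ha => (pos_of_pairPmf_pos ha).2) (fun a ha => by
      obtain ⟨h1, h2⟩ := pos_of_pairPmf_pos ha
      exact r₁_pos _ (pos_of_pairPmf_pos h1).2 h2) ht'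
  obtain ⟨c₃, hc₃⟩ := ev_ind_not_prod_le_le (lawV pJ D) _ _
    (fun a ha => (pos_of_pairPmf_pos ha).2) (fun a ha => by
      obtain ⟨h1, h2⟩ := pos_of_pairPmf_pos ha
      exact (hD _).rV_pos _ _ (pos_of_pairPmf_pos h1).2 h2) ht₃
  obtain ⟨c₂, hc₂⟩ := ev_ind_prod_le_le (lawY₂ pJ D W₂) _ (fun a ha => by
    obtain ⟨h1, h2⟩ := pos_of_pairPmf_pos ha
    obtain ⟨h3, h4⟩ := pos_of_pairPmf_pos h1
    obtain ⟨h5, h6⟩ := pos_of_pairPmf_pos h3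
    exact (hD _).d₂_pos _ _ _ _ (pos_of_pairPmf_pos h5).2 h6 h4 h2) ht₂'
  have hexp : ∀ {x : ℝ}, x < 0 → (2 : ℝ) ^ x ∈ Set.Ico (0 : ℝ) 1 := fun hx =>
    ⟨by positivity, Real.rpow_lt_one_of_one_lt_of_neg one_lt_two hx⟩
  -- With about `√n * γ₃` codewords per message, the factor `√n` is outweighed by the `1 / n` of
  -- Chebyshev's inequality, while the probability that no codeword is accepted is `exp (-√n)`.
  refine ⟨fun n => 2 ^ (n * t₁), fun n => 2 ^ (n * t'), fun n => 2 ^ (n * t₂),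
    fun n => 2 ^ (n * t₃), fun n => ⌈√n * (2 : ℝ) ^ (n * t₃)⌉₊, _,
    fun n => ⟨by positivity, by positivity, by positivity, by positivity⟩,
    tendsto_costBound (c₁ + c' + 2 * c₃) (c₂ + 1) (hexp (x := R₂ + t₃ - t₂) (by linarith))
      (hexp (x := R₁ - t₁) (by linarith)) (hexp (x := R₁ + t' - Rc - t₁) (by linarith)),
    fun n hn => ?_⟩
  have hn' : (0 : ℝ) < n := by exact_mod_cast hn
  refine (ev_costBound_le pJ D W₁ W₂ WZ _ _ _ _ _ _ _ _ _).trans ?_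
  have hpow : ∀ x : ℝ, ((2 : ℝ) ^ x) ^ n = 2 ^ (n * x) := fun x => by
    rw [← Real.rpow_natCast, ← Real.rpow_mul zero_le_two, mul_comm]
  -- The number of competitors is `⌈2 ^ (n x)⌉ - 1`, so this also covers negative rates, where the
  -- message is unique for large `n`.
  have hceil : ∀ x : ℝ, ((Fintype.card (Msg n x) : ℝ) - 1) ≤ 2 ^ (n * x) := by
    intro x
    rw [Fintype.card_fin]
    linarith [Nat.ceil_lt_add_one (show (0 : ℝ) ≤ 2 ^ (n * x) by positivity)]
  have hfloor : (2 : ℝ) ^ (n * Rc) / 2 ≤ Fintype.card (CoordMsg n Rc) := by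
    rw [Fintype.card_fin]
    have h1 : (1 : ℝ) ≤ 2 ^ (n * Rc) := Real.one_le_rpow one_le_two (by positivity)
    have h2 : (1 : ℝ) ≤ ⌊(2 : ℝ) ^ (n * Rc)⌋₊ := by
      exact_mod_cast Nat.le_floor (by exact_mod_cast h1)
    linarith [Nat.lt_floor_add_one ((2 : ℝ) ^ (n * Rc))]
  set g₃ : ℝ := 2 ^ (n * t₃) with hg₃
  have hg₃pos : 0 < g₃ := by positivity
  have hg₃one : 1 ≤ g₃ := Real.one_le_rpow one_le_two (mul_nonneg hn'.le (hcov.trans ht₃.le))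
  set L : ℕ := ⌈√n * g₃⌉₊
  have hL₁ : √n ≤ L / g₃ := (le_div_iff₀ hg₃pos).2 (Nat.le_ceil _)
  have hL₂ : L / g₃ ≤ √n + 1 := by
    rw [div_le_iff₀ hg₃pos]
    linarith [Nat.ceil_lt_add_one (show 0 ≤ √n * g₃ by positivity)]
  have hZ := ev_typeDev_le (lawZ pJ D WZ) (fun a => a.2) (outZ_mem_Icc pJ D WZ) (fun z => rfl) hn
  have hK : Real.exp (-(L / g₃)) ≤ Real.exp (-√n) := Real.exp_le_exp.2 (neg_le_neg hL₁)
  have hmain := mul_le_mul hL₂ (add_le_add (hc₂ n hn) hZ)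
    (add_nonneg (ev_nonneg _ fun _ => ind_nonneg _) (ev_nonneg _ fun _ => typeDev_nonneg _ _))
    (by positivity)
  have hcomp₂ : ((Fintype.card (Msg n R₂) : ℝ) - 1) * (L / (2 : ℝ) ^ (n * t₂)) ≤
      (√n + 1) * ((2 : ℝ) ^ (R₂ + t₃ - t₂)) ^ n := by
    calc ((Fintype.card (Msg n R₂) : ℝ) - 1) * (L / (2 : ℝ) ^ (n * t₂))
        ≤ 2 ^ (n * R₂) * (((√n + 1) * g₃) / (2 : ℝ) ^ (n * t₂)) := by
          have hL₃ : (L : ℝ) ≤ (√n + 1) * g₃ := (div_le_iff₀ hg₃pos).1 hL₂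
          have := hceil R₂
          gcongr
      _ = (√n + 1) * ((2 : ℝ) ^ (R₂ + t₃ - t₂)) ^ n := by
          rw [hpow, hg₃, mul_sub, mul_add, Real.rpow_sub two_pos, Real.rpow_add two_pos]
          ring
  have hcomp₁ : ((Fintype.card (Msg n R₁) : ℝ) - 1) * (1 / (2 : ℝ) ^ (n * t₁) +
      2 ^ (n * t') / (Fintype.card (CoordMsg n Rc) * 2 ^ (n * t₁))) ≤
      ((2 : ℝ) ^ (R₁ - t₁)) ^ n + 2 * ((2 : ℝ) ^ (R₁ + t' - Rc - t₁)) ^ n := by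
    calc ((Fintype.card (Msg n R₁) : ℝ) - 1) * (1 / (2 : ℝ) ^ (n * t₁) +
        2 ^ (n * t') / (Fintype.card (CoordMsg n Rc) * 2 ^ (n * t₁)))
        ≤ 2 ^ (n * R₁) * (1 / (2 : ℝ) ^ (n * t₁) +
          2 ^ (n * t') / ((2 ^ (n * Rc) / 2) * 2 ^ (n * t₁))) := by
          have := hceil R₁
          gcongr
      _ = _ := by
          rw [hpow, hpow]
          simp only [mul_sub, mul_add, Real.rpow_sub two_pos, Real.rpow_add two_pos]
          ring
  have e₁ := hc₁ n hn
  have e' := hc' n hn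
  have e₃ := hc₃ n hn
  rw [← add_div] at hmain
  have hsum : (c₁ + c' + 2 * c₃) / (n : ℝ) = c₁ / n + c' / n + 2 * (c₃ / n) := by ring
  rw [hsum]
  linarith

end CodingLaw


/-! ### Achievability -/

section Law

variable {X₁ X₂ Y₁ Y₂ Z : Type*} [Fintype Y₁] [Fintype Y₂] [Fintype Z] {n : ℕ} {R₁ R₂ Rc : ℝ}

lemma prob_law_eq (c : Code X₁ X₂ Y₁ Y₂ n R₁ R₂ Rc) (W₁ : Channel X₁ Y₁) (W₂ : Channel X₂ Y₂)
    (WZ : Channel (X₁ × X₂) Z) (E : Set (Outcome Y₁ Y₂ Z n R₁ R₂)) :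
    prob (c.law W₁ W₂ WZ) E =
      1 / ((Fintype.card (Msg n R₁) : ℝ) * (Fintype.card (Msg n R₂) : ℝ)) *
      ∑ m₁, ∑ m₂, ev (blockChannel W₁ n (c.enc₁ m₁)) fun y₁ =>
        ev (blockChannel W₂ n (c.enc₂ m₂ (c.coord m₁))) fun y₂ =>
          ev (piPmf fun i => WZ (c.enc₁ m₁ i, c.enc₂ m₂ (c.coord m₁) i)) fun z =>
            ind ((m₁, m₂, y₁, y₂, z) ∈ E) := by
  simp only [prob, Fintype.sum_prod_type, ev, Finset.mul_sum]
  refine Finset.sum_congr rfl fun m₁ _ => Finset.sum_congr rfl fun m₂ _ =>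
    Finset.sum_congr rfl fun y₁ _ => Finset.sum_congr rfl fun y₂ _ =>
    Finset.sum_congr rfl fun z _ => ?_
  by_cases h : (m₁, m₂, y₁, y₂, z) ∈ E
  · rw [Set.indicator_of_mem h, ind_of h, mul_one]
    simp only [Code.law, Finset.prod_mul_distrib, blockChannel, piPmf_apply, mul_assoc]
  · rw [Set.indicator_of_notMem h, ind_of_not h]
    simp

lemma prob_law_nonneg (c : Code X₁ X₂ Y₁ Y₂ n R₁ R₂ Rc) (W₁ : Channel X₁ Y₁) (W₂ : Channel X₂ Y₂)
    (WZ : Channel (X₁ × X₂) Z) (E : Set (Outcome Y₁ Y₂ Z n R₁ R₂)) :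
    0 ≤ prob (c.law W₁ W₂ WZ) E := by
  rw [prob_law_eq]
  exact mul_nonneg (by positivity) (Finset.sum_nonneg fun _ _ => Finset.sum_nonneg fun _ _ =>
    ev_nonneg _ fun _ => ev_nonneg _ fun _ => ev_nonneg _ fun _ => ind_nonneg _)

/-- The total cost of a code, over all message pairs: the error probabilities of the two decoders and
the expected deviation of the type of the interference from `Q`. -/
def Code.cost (c : Code X₁ X₂ Y₁ Y₂ n R₁ R₂ Rc) (W₁ : Channel X₁ Y₁) (W₂ : Channel X₂ Y₂)
    (WZ : Channel (X₁ × X₂) Z) (Q : Z → ℝ) : ℝ :=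
  ∑ m₁, ∑ m₂, (ev (blockChannel W₁ n (c.enc₁ m₁)) (fun y => ind (c.dec₁ y ≠ some m₁)) +
    (ev (blockChannel W₂ n (c.enc₂ m₂ (c.coord m₁))) (fun y => ind (c.dec₂ y ≠ some m₂)) +
      interferenceCost WZ (typeDev Q) (c.enc₁ m₁) (c.enc₂ m₂ (c.coord m₁))))

variable {W₁ : Channel X₁ Y₁} {W₂ : Channel X₂ Y₂} {WZ : Channel (X₁ × X₂) Z}

lemma interferenceCost_typeDev_nonneg (Q : Z → ℝ) (x₁ : Fin n → X₁) (x₂ : Fin n → X₂) :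
    0 ≤ interferenceCost WZ (typeDev Q) x₁ x₂ := ev_nonneg _ fun _ => typeDev_nonneg _ _

lemma one_div_mul_le_of_le_mul {M N x b : ℝ} (hM : 0 < M) (hN : 0 < N) (h : x ≤ M * N * b) :
    1 / (M * N) * x ≤ b := by
  rw [one_div_mul_eq_div, div_le_iff₀ (mul_pos hM hN)]
  linarith

lemma card_msg_pos (n : ℕ) (R : ℝ) : (0 : ℝ) < Fintype.card (Msg n R) := by
  rw [Fintype.card_fin]
  exact_mod_cast Nat.ceil_pos.2 (by positivity)

lemma prob_errorEvent_le (c : Code X₁ X₂ Y₁ Y₂ n R₁ R₂ Rc) (Q : Z → ℝ) {b : ℝ}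
    (h : c.cost W₁ W₂ WZ Q ≤ Fintype.card (Msg n R₁) * Fintype.card (Msg n R₂) * b) :
    prob (c.law W₁ W₂ WZ) (c.errorEvent Z) ≤ b := by
  rw [prob_law_eq]
  refine one_div_mul_le_of_le_mul (card_msg_pos n R₁) (card_msg_pos n R₂) (le_trans ?_ h)
  refine Finset.sum_le_sum fun m₁ _ => Finset.sum_le_sum fun m₂ _ => ?_
  refine (ev_mono _ fun y₁ => ev_mono _ fun y₂ => ev_mono _ fun z =>
    ind_or_le (c.dec₁ y₁ ≠ some m₁) (c.dec₂ y₂ ≠ some m₂)).trans ?_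
  simp only [ev_add, ev_const]
  have := interferenceCost_typeDev_nonneg (WZ := WZ) Q (c.enc₁ m₁) (c.enc₂ m₂ (c.coord m₁))
  linarith

lemma prob_interferenceEvent_le (c : Code X₁ X₂ Y₁ Y₂ n R₁ R₂ Rc) (Q : Z → ℝ) {b : ℝ}
    (h : c.cost W₁ W₂ WZ Q ≤ Fintype.card (Msg n R₁) * Fintype.card (Msg n R₂) * b) {ε : ℝ}
    (hε : 0 < ε) :
    prob (c.law W₁ W₂ WZ) (interferenceEvent Q ε) ≤
      (Fintype.card Z : ℝ) ^ 2 / (2 * ε) ^ 2 * b := by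
  rw [prob_law_eq]
  refine one_div_mul_le_of_le_mul (card_msg_pos n R₁) (card_msg_pos n R₂) ?_
  rw [mul_left_comm]
  refine le_trans ?_ (mul_le_mul_of_nonneg_left h (by positivity))
  rw [Code.cost, Finset.mul_sum]
  simp only [Finset.mul_sum]
  refine Finset.sum_le_sum fun m₁ _ => Finset.sum_le_sum fun m₂ _ => ?_
  refine (ev_mono _ fun y₁ => ev_mono _ fun y₂ => ev_mono _ fun z =>
    ind_le_tv_le Q z hε).trans ?_
  simp only [ev_const_mul, ev_const]
  refine mul_le_mul_of_nonneg_left ?_ (by positivity)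
  have h₁ := ev_nonneg (blockChannel W₁ n (c.enc₁ m₁)) fun y => ind_nonneg (c.dec₁ y ≠ some m₁)
  have h₂ := ev_nonneg (blockChannel W₂ n (c.enc₂ m₂ (c.coord m₁))) fun y =>
    ind_nonneg (c.dec₂ y ≠ some m₂)
  have h₃ : ev (piPmf fun i => WZ (c.enc₁ m₁ i, c.enc₂ m₂ (c.coord m₁) i)) (typeDev Q) =
    interferenceCost WZ (typeDev Q) (c.enc₁ m₁) (c.enc₂ m₂ (c.coord m₁)) := rfl
  linarith

end Law

/-- Achievability by random coding: for each value of a time-sharing variable `j ∼ pJ` a coding law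
describes how the codewords are drawn. -/
theorem achievable_of_codingLaw {J U V X₁ X₂ Y₁ Y₂ Z : Type*} [Fintype J] [Fintype U] [Fintype V]
    [Fintype X₁] [Fintype X₂] [Fintype Y₁] [Fintype Y₂] [Fintype Z] (pJ : stdSimplex ℝ J)
    (D : J → CodingLaw U V X₁ X₂ Y₁ Y₂) (W₁ : Channel X₁ Y₁) (W₂ : Channel X₂ Y₂)
    (WZ : Channel (X₁ × X₂) Z) (hD : ∀ j, (D j).Supported W₁ W₂) {R₁ R₂ Rc : ℝ}
    (h₁ : R₁ < CodingLaw.rate₁ pJ D W₁)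
    (h₂ : R₂ < CodingLaw.rate₂ pJ D W₂ - CodingLaw.coverRate pJ D)
    (hc : CodingLaw.coordRate pJ D < Rc) :
    Achievable W₁ W₂ WZ R₁ R₂ Rc (CodingLaw.outZ pJ D WZ) := by
  set Q := CodingLaw.outZ pJ D WZ with hQ
  have hQ01 := CodingLaw.outZ_mem_Icc pJ D WZ
  obtain ⟨γ₁, γ', γ₂, γ₃, L, B, hγ, hB, hcost⟩ :=
    CodingLaw.exists_thresholds pJ D WZ W₁ W₂ hD h₁ h₂ hc
  have hRc : 0 < Rc := (CodingLaw.coordRate_nonneg pJ D).trans_lt hc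
  obtain ⟨j₀⟩ := nonempty_of_pmf pJ
  obtain ⟨u₀⟩ := nonempty_of_pmf (D j₀).pU
  obtain ⟨v₀⟩ := nonempty_of_pmf (D j₀).rV
  have : Nonempty X₂ := nonempty_of_pmf ((D j₀).q₂ u₀ v₀)
  have hcode : ∀ n : ℕ, ∃ c : Code X₁ X₂ Y₁ Y₂ n R₁ R₂ Rc, 0 < n →
      c.cost W₁ W₂ WZ Q ≤ Fintype.card (Msg n R₁) * Fintype.card (Msg n R₂) * B n := by
    intro n
    have : Nonempty (CoordMsg n Rc) := by
      refine Fin.pos_iff_nonempty.1 (Nat.floor_pos.2 ?_)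
      exact Real.one_le_rpow one_le_two (by positivity)
    obtain ⟨j, hj⟩ := exists_le_of_ev_le (piPmf fun _ : Fin n => pJ) (le_refl
      (ev (piPmf fun _ : Fin n => pJ) fun j => (CodingLaw.pi fun i => D (j i)).costBound
        (blockChannel W₁ n) (blockChannel W₂ n) (interferenceCost WZ (typeDev Q))
        (γ₁ n) (γ' n) (γ₂ n) (γ₃ n) (L n) (Fintype.card (Msg n R₁)) (Fintype.card (Msg n R₂))
        (Fintype.card (CoordMsg n Rc))))
    obtain ⟨hγ₁, hγ', hγ₂, hγ₃⟩ := hγ n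
    obtain ⟨enc₁, enc₂, coord, dec₁, dec₂, h⟩ :=
      (CodingLaw.pi fun i => D (j i)).exists_code (C := CoordMsg n Rc) (M₁ := Msg n R₁)
        (M₂ := Msg n R₂) (blockChannel W₁ n) (blockChannel W₂ n)
        (G := interferenceCost WZ (typeDev Q)) (interferenceCost_typeDev_nonneg Q)
        (fun x₁ x₂ => ev_le_const _ fun z => typeDev_le_one hQ01 z) hγ₁ hγ' hγ₂ hγ₃ (L n)
    refine ⟨⟨enc₁, enc₂, coord, dec₁, dec₂⟩, fun hn => h.trans ?_⟩
    exact mul_le_mul_of_nonneg_left (hj.trans (hcost n hn)) (by positivity)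
  choose c hc using hcode
  refine ⟨CodingLaw.outZ_mem_stdSimplex pJ D WZ, c, ?_, fun ε hε => ?_⟩
  · refine squeeze_zero' (Eventually.of_forall fun n => prob_law_nonneg _ _ _ _ _) ?_ hB
    filter_upwards [eventually_gt_atTop 0] with n hn
    exact prob_errorEvent_le (c n) Q (hc n hn)
  · refine squeeze_zero' (Eventually.of_forall fun n => prob_law_nonneg _ _ _ _ _) ?_
      (by simpa using hB.const_mul ((Fintype.card Z : ℝ) ^ 2 / (2 * ε) ^ 2))
    filter_upwards [eventually_gt_atTop 0] with n hn
    exact prob_interferenceEvent_le (c n) Q (hc n hn) hε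


/-! ### From the single-letter region to coding laws -/

section Mixture

variable {A B C : Type*} [Fintype A] [Fintype B] [Fintype C]

/-- `outPmf` as a pmf. -/
def bindPmf (p : stdSimplex ℝ A) (κ : Channel A B) : stdSimplex ℝ B :=
  ⟨outPmf p κ,
    fun _ => Finset.sum_nonneg fun _ _ => mul_nonneg (stdSimplex.zero_le _ _) (stdSimplex.zero_le _ _),
    by
      simp only [outPmf]
      rw [Finset.sum_comm]
      simp [← Finset.mul_sum]⟩

lemma bindPmf_apply (p : stdSimplex ℝ A) (κ : Channel A B) (b : B) :
    bindPmf p κ b = ev p fun a => κ a b := rfl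

lemma coe_bindPmf (p : stdSimplex ℝ A) (κ : Channel A B) : ⇑(bindPmf p κ) = outPmf p κ := rfl

lemma ev_bindPmf (p : stdSimplex ℝ A) (κ : Channel A B) (f : B → ℝ) :
    ev (bindPmf p κ) f = ev p fun a => ev (κ a) f := by
  simp only [ev, bindPmf_apply, Finset.mul_sum, Finset.sum_mul]
  rw [Finset.sum_comm]
  exact Finset.sum_congr rfl fun _ _ => Finset.sum_congr rfl fun _ _ => by ring

lemma bindPmf_pos {p : stdSimplex ℝ A} {κ : Channel A B} {a : A} {b : B} (ha : 0 < p a)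
    (hb : 0 < κ a b) : 0 < bindPmf p κ b :=
  (mul_pos ha hb).trans_le (Finset.single_le_sum (f := fun a => p a * κ a b)
    (fun _ _ => mul_nonneg (stdSimplex.zero_le _ _) (stdSimplex.zero_le _ _)) (Finset.mem_univ a))

lemma exists_of_bindPmf_pos {p : stdSimplex ℝ A} {κ : Channel A B} {b : B}
    (h : 0 < bindPmf p κ b) : ∃ a, 0 < p a ∧ 0 < κ a b := by
  obtain ⟨a, -, ha⟩ := Finset.exists_ne_zero_of_sum_ne_zero h.ne'
  exact ⟨a, (stdSimplex.zero_le _ _).lt_of_ne' (left_ne_zero_of_mul ha),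
    (stdSimplex.zero_le _ _).lt_of_ne' (right_ne_zero_of_mul ha)⟩

open Classical in
/-- The pmf concentrated at `b`. -/
def pointPmf (b : B) : stdSimplex ℝ B := ⟨Pi.single b 1, single_mem_stdSimplex ℝ b⟩

open Classical in
lemma pointPmf_apply (b x : B) : pointPmf b x = if x = b then 1 else 0 := by
  change (Pi.single b 1 : B → ℝ) x = _
  rw [Pi.single_apply]

lemma eq_of_pointPmf_pos {b x : B} (h : 0 < pointPmf b x) : x = b := by
  by_contra hx
  rw [pointPmf_apply, if_neg hx] at h
  exact h.false

lemma ev_pointPmf (b : B) (f : B → ℝ) : ev (pointPmf b) f = f b := by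
  classical
  simp [ev, pointPmf_apply]

lemma pointPmf_self (b : B) : pointPmf b b = 1 := by simp [pointPmf_apply]

/-- The image of a pmf. -/
def mapPmf (f : A → B) (p : stdSimplex ℝ A) : stdSimplex ℝ B := bindPmf p fun a => pointPmf (f a)

lemma ev_mapPmf (f : A → B) (p : stdSimplex ℝ A) (g : B → ℝ) :
    ev (mapPmf f p) g = ev p fun a => g (f a) := by
  rw [mapPmf, ev_bindPmf]
  simp only [ev_pointPmf]

lemma exists_of_mapPmf_pos {f : A → B} {p : stdSimplex ℝ A} {b : B} (h : 0 < mapPmf f p b) :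
    ∃ a, f a = b ∧ 0 < p a := by
  obtain ⟨a, ha, hb⟩ := exists_of_bindPmf_pos h
  exact ⟨a, (eq_of_pointPmf_pos hb).symm, ha⟩

lemma mapPmf_apply_of_injective {f : A → B} (hf : Function.Injective f) (p : stdSimplex ℝ A) (a : A) :
    mapPmf f p (f a) = p a := by
  classical
  rw [mapPmf, bindPmf_apply]
  simp [ev, pointPmf_apply, hf.eq_iff]

/-- The density `P_{B|A} / P_B` has mean at most `1` over `A`. -/
lemma ev_div_bindPmf_le (p : stdSimplex ℝ A) (κ : Channel A B) (b : B) :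
    ev p (fun a => κ a b / bindPmf p κ b) ≤ 1 := by
  simp only [div_eq_inv_mul]
  rw [ev_const_mul, ← bindPmf_apply]
  exact inv_mul_le_one

/-- Mutual information as the mean of the information density. -/
lemma mutualInfo_jointPmf (p : stdSimplex ℝ A) (κ : Channel A B) :
    mutualInfo (jointPmf p κ) =
      ev p fun a => ev (κ a) fun b => Real.logb 2 (κ a b / bindPmf p κ b) := by
  simp only [mutualInfo, jointPmf, ev, Finset.mul_sum]
  refine Finset.sum_congr rfl fun a _ => Finset.sum_congr rfl fun b _ => ?_
  have hA : ∑ b', p a * κ a b' = p a := by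
    rw [← Finset.mul_sum, stdSimplex.sum_eq_one, mul_one]
  rw [hA, mul_assoc]
  rcases (stdSimplex.zero_le p a).eq_or_lt with h | h
  · rw [← h]; simp
  · rw [← Finset.mul_sum, mul_div_mul_left _ _ h.ne']; rfl

end Mixture

section SingleLetter

variable {J X₁ X₂ Y₁ Y₂ Z : Type*} [Fintype J] [Fintype X₁] [Fintype X₂] [Fintype Y₁] [Fintype Y₂]
  [Fintype Z] {k : J → ℕ} (PU : ∀ j, stdSimplex ℝ (Fin (k j))) (V₁ : ∀ j, Channel (Fin (k j)) X₁)
  (V₂ : ∀ j, Channel (Fin (k j)) X₂) (good : J → Prop) (W₁ : Channel X₁ Y₁) (W₂ : Channel X₂ Y₂)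

/-- The auxiliary codeword letter of user 2: the channel input itself if `P` holds, and the constant
letter `none`, which carries no information, otherwise. -/
def auxPmf (P : Prop) (p : stdSimplex ℝ X₂) : stdSimplex ℝ (Option X₂) :=
  open Classical in if P then mapPmf some p else pointPmf none

/-- The channel input of user 2 given the auxiliary letter: it is drawn afresh from `p` if the letter
is `none`. -/
def auxInput (p : stdSimplex ℝ X₂) (v : Option X₂) : stdSimplex ℝ X₂ := v.elim p pointPmf

lemma auxPmf_some_pos {P : Prop} {p : stdSimplex ℝ X₂} {x : X₂} (h : 0 < auxPmf P p (some x)) :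
    P ∧ 0 < p x := by
  unfold auxPmf at h
  split_ifs at h with hP
  · exact ⟨hP, by rwa [mapPmf_apply_of_injective (Option.some_injective _)] at h⟩
  · exact absurd (eq_of_pointPmf_pos h) (by simp)

lemma auxPmf_none_pos {P : Prop} {p : stdSimplex ℝ X₂} (h : 0 < auxPmf P p none) : ¬P := by
  intro hP
  rw [auxPmf, if_pos hP] at h
  obtain ⟨x, hx, -⟩ := exists_of_mapPmf_pos h
  simp at hx

lemma ev_auxPmf_auxInput (P : Prop) (p : stdSimplex ℝ X₂) (f : X₂ → ℝ) :
    (ev (auxPmf P p) fun v => ev (auxInput p v) f) = ev p f := by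
  by_cases hP : P
  · rw [auxPmf, if_pos hP, ev_mapPmf]
    simp only [auxInput, Option.elim_some, ev_pointPmf]
  · rw [auxPmf, if_neg hP, ev_pointPmf]
    rfl

/-- The coding laws of a family of single-letter distributions indexed by a time-sharing variable
`j`. User 2 communicates in the letters `j` where `good j` holds; in the others its input only follows
the coordination variable. -/
def familyLaw (j : J) : CodingLaw (Σ j, Fin (k j)) (Option X₂) X₁ X₂ Y₁ Y₂ where
  pU := mapPmf (Sigma.mk j) (PU j)
  q₁ u := V₁ u.1 u.2
  qV u := auxPmf (good j) (V₂ u.1 u.2)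
  q₂ u := auxInput (V₂ u.1 u.2)
  r₁ := bindPmf (PU j) (V₁ j)
  rV := auxPmf (good j) (bindPmf (PU j) (V₂ j))
  d₁ x y := W₁ x y / bindPmf (bindPmf (PU j) (V₁ j)) W₁ y
  d₂ v y := v.elim 1 fun x => W₂ x y / bindPmf (bindPmf (PU j) (V₂ j)) W₂ y
  d₁_nonneg _ _ := div_nonneg (stdSimplex.zero_le _ _) (stdSimplex.zero_le _ _)
  d₂_nonneg v _ := by
    rcases v with _ | x
    · exact zero_le_one
    · exact div_nonneg (stdSimplex.zero_le _ _) (stdSimplex.zero_le _ _)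
  ev_q₁_le x := by rw [ev_mapPmf, bindPmf_apply]
  ev_d₁_le y := ev_div_bindPmf_le _ _ _
  ev_d₂_le y := by
    by_cases hj : good j
    · rw [auxPmf, if_pos hj, ev_mapPmf]
      exact ev_div_bindPmf_le _ _ _
    · rw [auxPmf, if_neg hj, ev_pointPmf]
      exact le_rfl

lemma familyLaw_supported (j : J) :
    (familyLaw PU V₁ V₂ good W₁ W₂ j).Supported W₁ W₂ where
  rV_pos u v hu hv := by
    obtain ⟨a, rfl, ha⟩ := exists_of_mapPmf_pos hu
    rcases v with _ | x
    · have hj := auxPmf_none_pos hv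
      change 0 < auxPmf _ _ _
      rw [auxPmf, if_neg hj, pointPmf_self]
      exact one_pos
    · obtain ⟨hj, hx⟩ := auxPmf_some_pos hv
      change 0 < auxPmf _ _ _
      rw [auxPmf, if_pos hj, mapPmf_apply_of_injective (Option.some_injective _)]
      exact bindPmf_pos ha hx
  d₁_pos u x y hu hx hy := by
    obtain ⟨a, rfl, ha⟩ := exists_of_mapPmf_pos hu
    exact div_pos hy (bindPmf_pos (bindPmf_pos ha hx) hy)
  d₂_pos u v x y hu hv hx hy := by
    obtain ⟨a, rfl, ha⟩ := exists_of_mapPmf_pos hu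
    rcases v with _ | x'
    · exact one_pos
    · obtain ⟨-, hx'⟩ := auxPmf_some_pos hv
      obtain rfl := eq_of_pointPmf_pos hx
      exact div_pos hy (bindPmf_pos (bindPmf_pos ha hx') hy)

variable (pJ : stdSimplex ℝ J)

lemma rate₁_familyLaw :
    CodingLaw.rate₁ pJ (familyLaw PU V₁ V₂ good W₁ W₂) W₁ =
      ev pJ fun j => mutualInfo (jointPmf (outPmf (PU j) (V₁ j)) W₁) := by
  simp only [CodingLaw.rate₁, CodingLaw.lawY₁, CodingLaw.lawX₁, ev_pairPmf]
  refine congrArg _ (funext fun j => ?_)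
  rw [← coe_bindPmf, mutualInfo_jointPmf, ev_bindPmf]
  exact ev_mapPmf _ _ _

lemma coordRate_familyLaw :
    CodingLaw.coordRate pJ (familyLaw PU V₁ V₂ good W₁ W₂) =
      ev pJ fun j => mutualInfo (jointPmf (PU j) (V₁ j)) := by
  simp only [CodingLaw.coordRate, CodingLaw.lawX₁, ev_pairPmf]
  refine congrArg _ (funext fun j => ?_)
  rw [mutualInfo_jointPmf]
  exact ev_mapPmf _ _ _

open Classical in
lemma coverRate_familyLaw :
    CodingLaw.coverRate pJ (familyLaw PU V₁ V₂ good W₁ W₂) =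
      ev pJ fun j => if good j then mutualInfo (jointPmf (PU j) (V₂ j)) else 0 := by
  simp only [CodingLaw.coverRate, CodingLaw.lawV, ev_pairPmf]
  refine congrArg _ (funext fun j => ?_)
  refine (ev_mapPmf _ _ _).trans ?_
  by_cases hj : good j
  · rw [if_pos hj, mutualInfo_jointPmf]
    refine congrArg _ (funext fun a => ?_)
    simp only [familyLaw, auxPmf, if_pos hj, ev_mapPmf,
      mapPmf_apply_of_injective (Option.some_injective _)]
  · rw [if_neg hj]
    simp only [familyLaw, auxPmf, if_neg hj, ev_pointPmf, pointPmf_self]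
    simp

open Classical in
lemma rate₂_familyLaw :
    CodingLaw.rate₂ pJ (familyLaw PU V₁ V₂ good W₁ W₂) W₂ =
      ev pJ fun j => if good j then mutualInfo (jointPmf (outPmf (PU j) (V₂ j)) W₂) else 0 := by
  simp only [CodingLaw.rate₂, CodingLaw.lawY₂, CodingLaw.lawV, ev_pairPmf]
  refine congrArg _ (funext fun j => ?_)
  refine (ev_mapPmf _ _ _).trans ?_
  by_cases hj : good j
  · rw [if_pos hj, ← coe_bindPmf, mutualInfo_jointPmf, ev_bindPmf]
    refine congrArg _ (funext fun a => ?_)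
    simp only [familyLaw, auxPmf, if_pos hj, ev_mapPmf, auxInput, Option.elim_some, ev_pointPmf]
  · rw [if_neg hj]
    simp only [familyLaw, auxPmf, if_neg hj, ev_pointPmf]
    simp

lemma outZ_familyLaw (WZ : Channel (X₁ × X₂) Z) (z : Z) :
    CodingLaw.outZ pJ (familyLaw PU V₁ V₂ good W₁ W₂) WZ z = ev pJ fun j =>
      ∑ u, ∑ x₁, ∑ x₂, PU j u * V₁ j u x₁ * V₂ j u x₂ * WZ (x₁, x₂) z := by
  simp only [CodingLaw.outZ, CodingLaw.lawZ, CodingLaw.lawX₁, ev_pairPmf]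
  refine congrArg _ (funext fun j => ?_)
  refine (ev_mapPmf _ _ _).trans ?_
  have hz : ∀ p : stdSimplex ℝ Z, ev p (fun z' => ind (z' = z)) = p z := fun p => by
    classical
    simp [ev, ind]
  simp only [hz, familyLaw]
  have haux : ∀ a x₁, (ev (auxPmf (good j) (V₂ j a)) fun v => ev (auxInput (V₂ j a) v) fun x₂ =>
      WZ (x₁, x₂) z) = ev (V₂ j a) fun x₂ => WZ (x₁, x₂) z := fun a x₁ =>
    ev_auxPmf_auxInput _ _ _
  simp only [haux]
  simp only [ev, Finset.mul_sum, mul_assoc]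

end SingleLetter

lemma ev_lt_ev {A : Type*} [Fintype A] (p : stdSimplex ℝ A) {f g : A → ℝ} (h : ∀ a, f a < g a) :
    ev p f < ev p g := by
  by_contra! hc
  have h1 : ev p (fun a => g a - f a) ≤ 0 := by rw [ev_sub]; linarith
  obtain ⟨a, ha⟩ := exists_le_of_ev_le p h1
  linarith [h a]

end CommInterf

end

theorem theorem2 {X₁ X₂ Y₁ Y₂ Z : Type*} [Fintype X₁] [Fintype X₂]
    [Fintype Y₁] [Fintype Y₂] [Fintype Z]
    (W₁ : CommInterf.Channel X₁ Y₁) (W₂ : CommInterf.Channel X₂ Y₂)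
    (WZ : CommInterf.Channel (X₁ × X₂) Z) :
    convexHull ℝ (CommInterf.singleLetterRegion W₁ W₂ WZ) ⊆
      CommInterf.capacityRegion W₁ W₂ WZ := by
  open CommInterf in
  classical
  intro x hx
  obtain ⟨J, _, w, ξ, hw₀, hw₁, hξ, rfl⟩ := mem_convexHull_iff_exists_fintype.1 hx
  choose k PU V₁ V₂ h₁ h₂ hc hQ using hξ
  let pJ : stdSimplex ℝ J := ⟨w, hw₀, hw₁⟩
  have hsum : ∀ f : J → ℝ, ev pJ f = ∑ j, w j * f j := fun f => rfl
  let good : J → Prop := fun j =>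
    0 ≤ mutualInfo (jointPmf (outPmf (PU j) (V₂ j)) W₂) - mutualInfo (jointPmf (PU j) (V₂ j))
  have key := achievable_of_codingLaw pJ (familyLaw PU V₁ V₂ good W₁ W₂) W₁ W₂ WZ
    (familyLaw_supported PU V₁ V₂ good W₁ W₂) (R₁ := ∑ j, w j * (ξ j).1)
    (R₂ := ∑ j, w j * (ξ j).2.1) (Rc := ∑ j, w j * (ξ j).2.2.1)
    (by
      rw [rate₁_familyLaw, ← hsum]
      exact ev_lt_ev pJ h₁)
    (by
      rw [rate₂_familyLaw, coverRate_familyLaw, ← hsum, ← ev_sub]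
      refine ev_lt_ev pJ fun j => (h₂ j).trans_eq ?_
      by_cases hj : good j
      · rw [if_pos hj, if_pos hj, max_eq_left hj]
      · rw [if_neg hj, if_neg hj, max_eq_right (not_le.1 hj).le, sub_zero])
    (by
      rw [coordRate_familyLaw, ← hsum]
      exact ev_lt_ev pJ hc)
  refine subset_closure ?_
  have hx : ∑ j, w j • ξ j = (∑ j, w j * (ξ j).1, ∑ j, w j * (ξ j).2.1, ∑ j, w j * (ξ j).2.2.1,
      CodingLaw.outZ pJ (familyLaw PU V₁ V₂ good W₁ W₂) WZ) := by
    refine Prod.ext ?_ (Prod.ext ?_ (Prod.ext ?_ (funext fun z => ?_)))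
    · simp [Prod.fst_sum]
    · simp [Prod.fst_sum, Prod.snd_sum]
    · simp [Prod.fst_sum, Prod.snd_sum]
    · dsimp only
      rw [outZ_familyLaw, hsum]
      simp only [Prod.snd_sum, Finset.sum_apply, Prod.smul_snd, Pi.smul_apply, smul_eq_mul]
      exact Finset.sum_congr rfl fun j _ => by rw [hQ j z]
  rw [hx]
  exact key
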